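/- Let $(N,\beta)$ be a smooth symplectic manifold of dimension $2m$, $m\ge 1$ (so $\beta$ is a smooth closed nondegenerate $2$-form), let $H:N\to\mathbb{R}$ be a smooth function (an autonomous Hamiltonian), and let $\tilde z\in N$ be a point with $dH(\tilde z)\neq 0$. Let $(x,p)=(x^1,\dots,x^m,p_1,\dots,p_m)$ be canonical coordinates in a neighborhood of $\tilde z$, i.e. smooth local coordinates with $\beta=dp_i\wedge dx^i$ (summation over $i=1,\dots,m$), and denote by $(\tilde x,\tilde p)$ the coordinates of $\tilde z$. (a) In some neighborhood $U$ of $\tilde z$ there exist smooth coordinates $Z=(X,P)=(X^1,\dots,X^m,P_1,\dots,P_m)$, $Z=Z(x,p)$, such that 1) $dp_i\wedge dx^i=dP_i\wedge dX^i$ on $U$ (so $(X,P)$ are again canonical coordinates); 2) in the coordinates $Z$ the Hamiltonian has the form $H=X^1$. (b) If $\frac{\partial H}{\partial p_1}(\tilde z)\ne 0$ (which can always be achieved by a canonical permutation of the coordinates $(x,p)$), then the coordinates in (a) can be chosen so that they are given by a generating function: there are an open set $W\subset\mathbb{R}^m\times\mathbb{R}^m$ containing $(x(z),X(z))$ for all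 $z\in U$ and a smooth function $S=S(x,X)$ on $W$ with $\det\big(\frac{\partial^2 S}{\partial x^i\partial X^j}\big)\ne0$ on $W$, such that on $U$ $$p_i=\frac{\partial S}{\partial x^i}(x,X),\qquad P_i=-\frac{\partial S}{\partial X^i}(x,X),\qquad i=1,\dots,m,$$ and $S$ solves on $W$ the Cauchy problem for the Hamilton–Jacobi equation with parameters $X$ $$H\Big(x,\frac{\partial S}{\partial x}\Big)=X^1,\qquad S\big|_{x^1=\tilde x^1}=\sum_{k=2}^m x^kX^k .$$ -/

import Mathlib

open scoped Manifold ContDiff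

noncomputable section

namespace HamStraight

/-- The coordinate space `ℝ^m × ℝ^m`; a point is `(x, p)` with `x = (x^1, …, x^m)` and
`p = (p_1, …, p_m)`. The index `1` of the mathematical notation is `0 : Fin m`. -/
abbrev PhaseSpace (m : ℕ) : Type := (Fin m → ℝ) × (Fin m → ℝ)

/-- A (not necessarily continuous) field of alternating 2-forms on the tangent spaces of `N`. -/
abbrev TwoForm (m : ℕ) (N : Type*) [TopologicalSpace N] [ChartedSpace (PhaseSpace m) N] :=
  ∀ z : N, (TangentSpace 𝓘(ℝ, PhaseSpace m) z) [⋀^Fin 2]→L[ℝ] ℝ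

/-- A system of smooth local coordinates `(x, p)` on `N`. The coordinate functions at `z` are
`x^i = (e z).1 i` and `p_i = (e z).2 i`. -/
abbrev LocalCoords (m : ℕ) (N : Type*) [TopologicalSpace N] := OpenPartialHomeomorph N (PhaseSpace m)

section Manifold

variable {m : ℕ} {N : Type*} [TopologicalSpace N] [ChartedSpace (PhaseSpace m) N]

/-- The differential of a real function at a point of `N`. -/
def diff (f : N → ℝ) (z : N) : TangentSpace 𝓘(ℝ, PhaseSpace m) z →L[ℝ] ℝ :=
  mfderiv 𝓘(ℝ, PhaseSpace m) 𝓘(ℝ, ℝ) f z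

/-- The expression of a 2-form in local coordinates: its pullback by the inverse of the chart. -/
def TwoForm.localRep (β : TwoForm m N) (e : LocalCoords m N) (y : PhaseSpace m) :
    PhaseSpace m [⋀^Fin 2]→L[ℝ] ℝ :=
  (β (e.symm y)).compContinuousLinearMap
    (mfderiv 𝓘(ℝ, PhaseSpace m) 𝓘(ℝ, PhaseSpace m) e.symm y)

/-- A symplectic form: a smooth, closed, nondegenerate 2-form. -/
structure IsSymplectic (β : TwoForm m N) : Prop where
  smooth : ∀ e ∈ atlas (PhaseSpace m) N, ContDiffOn ℝ ∞ (β.localRep e) e.target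
  closed : ∀ e ∈ atlas (PhaseSpace m) N, ∀ y ∈ e.target, extDeriv (β.localRep e) y = 0
  nondegenerate : ∀ (z : N) (u : TangentSpace 𝓘(ℝ, PhaseSpace m) z),
    (∀ v : TangentSpace 𝓘(ℝ, PhaseSpace m) z, β z ![u, v] = 0) → u = 0

/-- The value of the 2-form `dp_i ∧ dx^i` (summation over `i`) of local coordinates `(x, p)`
on the pair of tangent vectors `u, v` at `z`. -/
def dpdx (e : LocalCoords m N) (z : N) (u v : TangentSpace 𝓘(ℝ, PhaseSpace m) z) : ℝ :=
  ∑ i : Fin m,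
    (diff (fun z' => (e z').2 i) z u * diff (fun z' => (e z').1 i) z v
      - diff (fun z' => (e z').2 i) z v * diff (fun z' => (e z').1 i) z u)

/-- Canonical coordinates of `(N, β)`: smooth local coordinates in which `β = dp_i ∧ dx^i`. -/
structure IsCanonical (β : TwoForm m N) (e : LocalCoords m N) : Prop where
  smooth : e ∈ IsManifold.maximalAtlas 𝓘(ℝ, PhaseSpace m) ∞ N
  form_eq : ∀ z ∈ e.source, ∀ u v : TangentSpace 𝓘(ℝ, PhaseSpace m) z,
    β z ![u, v] = dpdx e z u v

/-- `Z = (X, P)` are smooth coordinates in a neighbourhood `U = Z.source` of `z₀`, inside the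
domain of the coordinates `e = (x, p)`, such that `dp_i ∧ dx^i = dP_i ∧ dX^i` and `H = X^1`
on `U`. -/
structure IsStraightening [NeZero m] (e : LocalCoords m N) (H : N → ℝ) (z₀ : N)
    (Z : LocalCoords m N) : Prop where
  smooth : Z ∈ IsManifold.maximalAtlas 𝓘(ℝ, PhaseSpace m) ∞ N
  mem_source : z₀ ∈ Z.source
  source_subset : Z.source ⊆ e.source
  form_eq : ∀ z ∈ Z.source, ∀ u v : TangentSpace 𝓘(ℝ, PhaseSpace m) z,
    dpdx e z u v = dpdx Z z u v
  hamiltonian_eq : ∀ z ∈ Z.source, H z = (Z z).1 0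

end Manifold

section GeneratingFunction

variable {m : ℕ}

/-- For `S = S(x, X)`: the vector `∂S/∂x = (∂S/∂x^1, …, ∂S/∂x^m)` at `w = (x, X)`. -/
def gradFst (S : (Fin m → ℝ) × (Fin m → ℝ) → ℝ) (w : (Fin m → ℝ) × (Fin m → ℝ)) : Fin m → ℝ :=
  fun i => fderiv ℝ S w (Pi.single i 1, 0)

/-- For `S = S(x, X)`: the vector `∂S/∂X = (∂S/∂X^1, …, ∂S/∂X^m)` at `w = (x, X)`. -/
def gradSnd (S : (Fin m → ℝ) × (Fin m → ℝ) → ℝ) (w : (Fin m → ℝ) × (Fin m → ℝ)) : Fin m → ℝ :=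
  fun i => fderiv ℝ S w (0, Pi.single i 1)

/-- For `S = S(x, X)`: the matrix `∂²S/∂x^i∂X^j` at `w = (x, X)`. -/
def mixedHessian (S : (Fin m → ℝ) × (Fin m → ℝ) → ℝ) (w : (Fin m → ℝ) × (Fin m → ℝ)) :
    Matrix (Fin m) (Fin m) ℝ :=
  Matrix.of fun i j => fderiv ℝ (fun w' => gradFst S w' i) w (0, Pi.single j 1)

variable {N : Type*} [TopologicalSpace N]

/-- `S = S(x, X)`, smooth and with `det (∂²S/∂x∂X) ≠ 0` on the open set `W`, is a generating
function of the transformation from the coordinates `e = (x, p)` to `Z = (X, P)`: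
`p = ∂S/∂x (x, X)` and `P = -∂S/∂X (x, X)`. -/
structure IsGeneratingFunction (e Z : LocalCoords m N) (W : Set ((Fin m → ℝ) × (Fin m → ℝ)))
    (S : (Fin m → ℝ) × (Fin m → ℝ) → ℝ) : Prop where
  isOpen : IsOpen W
  smooth : ContDiffOn ℝ ∞ S W
  det_ne_zero : ∀ w ∈ W, (mixedHessian S w).det ≠ 0
  mem : ∀ z ∈ Z.source, ((e z).1, (Z z).1) ∈ W
  momentum_eq : ∀ z ∈ Z.source, (e z).2 = gradFst S ((e z).1, (Z z).1)
  newMomentum_eq : ∀ z ∈ Z.source, (Z z).2 = -gradSnd S ((e z).1, (Z z).1)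

/-- `S = S(x, X)` solves on `W`, for all values of the parameters `X`, the Cauchy problem
`H(x, ∂S/∂x) = X^1`, `S = ∑_{k ≥ 2} x^k X^k` for `x^1 = c`,
where `H` is written in the coordinates `e = (x, p)`. -/
structure SolvesCauchyProblem [NeZero m] (e : LocalCoords m N) (H : N → ℝ) (c : ℝ)
    (W : Set ((Fin m → ℝ) × (Fin m → ℝ))) (S : (Fin m → ℝ) × (Fin m → ℝ) → ℝ) : Prop where
  mem_target : ∀ w ∈ W, (w.1, gradFst S w) ∈ e.target
  hamiltonJacobi : ∀ w ∈ W, H (e.symm (w.1, gradFst S w)) = w.2 0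
  initial : ∀ w ∈ W, w.1 0 = c → S w = ∑ k ∈ Finset.univ.erase (0 : Fin m), w.1 k * w.2 k

end GeneratingFunction

end HamStraight

end

/-! The proof is the method of characteristics, with the values X of the parameters carried along as
variables. Write h for H in the coordinates (x, p) and suppose ∂h/∂p_1 ≠ 0 at the base point. On the
hyperplane x^1 = c the Cauchy data prescribe p_k = X^k for k ≥ 2, and h(x, p) = X^1 then determines
p_1 by the inverse function theorem. The Hamiltonian flow, enlarged by ṡ = p · ∂h/∂p, carries these
points off the hyperplane. With q^2, …, q^m as initial position and q^1 - c as time, this gives a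
family ((x, p), s) depending smoothly on (q, X).

Everything rests on one identity for this family (`IsCharacteristicFamily.form`): ds = p dx + (q - c
e₁) dX. It holds because along the flow ds - p dx, evaluated on a variation of the initial point,
grows at the constant rate dh. It is used in two ways. Since ẋ^1 = ∂h/∂p_1 ≠ 0, the map (q, X) ↦ (x,
X) is locally invertible, so s becomes a function S(x, X) with ∂S/∂x = p and ∂S/∂X = q - c e₁;
conservation of energy turns h = X^1 into the Hamilton–Jacobi equation. Taking the exterior
derivative of the identity gives dp ∧ dx = dX ∧ dq, so (X, P) with P = c e₁ - q = -∂S/∂X is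
canonical; (q, X) ↦ (x, p) is also locally invertible, so these are coordinates near the base point.

Without the assumption on ∂h/∂p_1, a linear symplectic change of coordinates (a transposition of
indices, possibly combined with (x, p) ↦ (p, -x)) reduces (a) to that case. Smooth dependence of the
flow on time and initial value is obtained from the inverse function theorem in the Banach space of
continuous paths. -/

namespace HamStraight

open Set Filter Topology

universe u

/-! ### The smooth inverse function theorem -/

section InverseFunction

variable {E F : Type*} [NormedAddCommGroup E] [NormedSpace ℝ E] [CompleteSpace E]
  [NormedAddCommGroup F] [NormedSpace ℝ F]

/-- Inverse function theorem for smooth maps, with smoothness of the inverse on its whole domain. -/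
theorem exists_smooth_openPartialHomeomorph {f : E → F} {s : Set E} (hs : IsOpen s)
    (hf : ContDiffOn ℝ ∞ f s) {a : E} (ha : a ∈ s) (f' : E ≃L[ℝ] F)
    (hf' : HasFDerivAt f (f' : E →L[ℝ] F) a) :
    ∃ Ψ : OpenPartialHomeomorph E F, a ∈ Ψ.source ∧ Ψ.source ⊆ s ∧ (Ψ : E → F) = f ∧
      ContDiffOn ℝ ∞ Ψ.symm Ψ.target ∧
      ∀ x ∈ Ψ.source, Function.Injective (fderiv ℝ f x) := by
  have hfa : ContDiffAt ℝ ∞ f a := hf.contDiffAt (hs.mem_nhds ha)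
  have hn : (∞ : WithTop ℕ∞) ≠ 0 := by simp
  let Ψ₀ := hfa.toOpenPartialHomeomorph f hf' hn
  -- Invertible operators form an open set, so the domain can be cut down to points with invertible
  -- derivative; this makes the inverse smooth on the whole target, not just at the image of `a`.
  have hopen : IsOpen (s ∩ fderiv ℝ f ⁻¹' range ((↑) : (E ≃L[ℝ] F) → E →L[ℝ] F)) :=
    (hf.continuousOn_fderiv_of_isOpen hs (by simp)).isOpen_inter_preimage hs
      (ContinuousLinearEquiv.isOpen)
  refine ⟨Ψ₀.restrOpen _ hopen, ⟨hfa.mem_toOpenPartialHomeomorph_source hf' hn, ha, f', ?_⟩,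
    fun x hx => hx.2.1, rfl, ?_, ?_⟩
  · exact hf'.fderiv.symm
  · intro y hy
    have hx := (Ψ₀.restrOpen _ hopen).map_target hy
    obtain ⟨-, hxs, g, hg⟩ := hx
    refine ContDiffAt.contDiffWithinAt ?_
    refine (Ψ₀.restrOpen _ hopen).contDiffAt_symm (f₀' := g) hy ?_
      (hf.contDiffAt (hs.mem_nhds hxs))
    rw [hg]
    exact ((hf.contDiffAt (hs.mem_nhds hxs)).differentiableAt (by simp)).hasFDerivAt
  · rintro x ⟨-, -, g, hg⟩
    rw [← hg]
    exact g.injective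

/-- In finite dimension, it suffices that the derivative is injective. -/
theorem exists_smooth_openPartialHomeomorph_of_injective [FiniteDimensional ℝ E] {f : E → E}
    {s : Set E} (hs : IsOpen s) (hf : ContDiffOn ℝ ∞ f s) {a : E} (ha : a ∈ s)
    (hinj : Function.Injective (fderiv ℝ f a)) :
    ∃ Ψ : OpenPartialHomeomorph E E, a ∈ Ψ.source ∧ Ψ.source ⊆ s ∧ (Ψ : E → E) = f ∧
      ContDiffOn ℝ ∞ Ψ.symm Ψ.target ∧
      ∀ x ∈ Ψ.source, Function.Injective (fderiv ℝ f x) := by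
  let g : E ≃L[ℝ] E :=
    (LinearEquiv.ofInjectiveEndo (fderiv ℝ f a).toLinearMap hinj).toContinuousLinearEquiv
  refine exists_smooth_openPartialHomeomorph hs hf ha g ?_
  have : (g : E →L[ℝ] E) = fderiv ℝ f a := by
    ext x
    rfl
  rw [this]
  exact ((hf.contDiffAt (hs.mem_nhds ha)).differentiableAt (by simp)).hasFDerivAt

end InverseFunction

/-! ### Composition operators on spaces of continuous functions -/

section Nemytskii

variable {K : Type*} [TopologicalSpace K] [CompactSpace K]
variable {E F : Type*} [NormedAddCommGroup E] [NormedSpace ℝ E]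
  [NormedAddCommGroup F] [NormedSpace ℝ F]

/-- Pointwise application of a continuous family of operators to a continuous family of vectors,
as a bounded linear operator in the family of operators. -/
noncomputable def pointwiseApply (K : Type*) [TopologicalSpace K] [CompactSpace K] (E F : Type*)
    [NormedAddCommGroup E] [NormedSpace ℝ E] [NormedAddCommGroup F] [NormedSpace ℝ F] :
    C(K, E →L[ℝ] F) →L[ℝ] C(K, E) →L[ℝ] C(K, F) :=
  LinearMap.mkContinuous₂
    (LinearMap.mk₂ ℝ (fun (A : C(K, E →L[ℝ] F)) (η : C(K, E)) =>
        (⟨fun k => A k (η k), A.continuous.clm_apply η.continuous⟩ : C(K, F)))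
      (fun _ _ _ => by ext; simp) (fun _ _ _ => by ext; simp)
      (fun _ _ _ => by ext; simp) (fun _ _ _ => by ext; simp)) 1
    (fun A η => by
      rw [one_mul]
      refine (ContinuousMap.norm_le _ (by positivity)).2 fun k => ?_
      refine ((A k).le_opNorm _).trans ?_
      gcongr
      exacts [A.norm_coe_le_norm k, η.norm_coe_le_norm k])

@[simp]
theorem pointwiseApply_apply (A : C(K, E →L[ℝ] F)) (η : C(K, E)) (k : K) :
    pointwiseApply K E F A η k = A k (η k) := rfl

/-- Compactness of `K` makes `η ↦ f' ∘ η` continuous for the sup norm. Hence `f'` is within ε of `f'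
(γ k)` on the segment from `γ k` to `η k`, uniformly in `k`, and the mean value inequality on each
segment gives the little-o estimate. -/
theorem hasFDerivAt_postcomp {f : C(E, F)} {f' : C(E, E →L[ℝ] F)}
    (hf : ∀ x, HasFDerivAt f (f' x) x) (γ : C(K, E)) :
    HasFDerivAt (fun η : C(K, E) => f.comp η) (pointwiseApply K E F (f'.comp γ)) γ := by
  rw [hasFDerivAt_iff_isLittleO, Asymptotics.isLittleO_iff]
  intro ε hε
  have hc : ContinuousAt (fun η : C(K, E) => f'.comp η) γ :=
    (ContinuousMap.continuous_postcomp f').continuousAt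
  obtain ⟨δ, hδ, hball⟩ := (Metric.continuousAt_iff (f := fun η : C(K, E) => f'.comp η)).1 hc ε hε
  filter_upwards [Metric.ball_mem_nhds γ hδ] with η hη
  refine (ContinuousMap.norm_le _ (by positivity)).2 fun k => ?_
  have key : ∀ x ∈ segment ℝ (γ k) (η k), ‖f' x - f' (γ k)‖ ≤ ε := by
    intro x hx
    rw [segment_eq_image'] at hx
    obtain ⟨θ, hθ, rfl⟩ := hx
    have hmem : dist (γ + θ • (η - γ)) γ < δ := by
      rw [dist_eq_norm, add_sub_cancel_left, norm_smul, Real.norm_of_nonneg hθ.1]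
      rw [Metric.mem_ball, dist_eq_norm] at hη
      exact (mul_le_of_le_one_left (norm_nonneg _) hθ.2).trans_lt hη
    have := (ContinuousMap.dist_apply_le_dist k).trans (hball hmem).le
    rw [dist_eq_norm] at this
    simpa using this
  have hmv := (convex_segment (𝕜 := ℝ) (γ k) (η k)).norm_image_sub_le_of_norm_hasFDerivWithin_le'
    (f := f) (f' := fun x => f' x) (φ := f' (γ k))
    (fun x _ => (hf x).hasFDerivWithinAt) key (left_mem_segment ℝ _ _) (right_mem_segment ℝ _ _)
  refine (le_of_eq_of_le ?_ hmv).trans ?_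
  · simp
  · gcongr
    exact (η - γ).norm_coe_le_norm k

/-- Composition with a smooth map is a smooth map between spaces of continuous functions. -/
theorem contDiff_postcomp_nat (n : ℕ) {E F : Type u} [NormedAddCommGroup E] [NormedSpace ℝ E]
    [NormedAddCommGroup F] [NormedSpace ℝ F]
    (f : C(E, F)) (hf : ContDiff ℝ ∞ f) :
    ContDiff ℝ n (fun η : C(K, E) => f.comp η) := by
  -- The derivative is a bounded linear function of composition with `fderiv ℝ f`, whose codomain is
  -- `E →L[ℝ] F`. The codomain therefore has to vary in the induction, and sharing one universe
  -- between `E` and `F` keeps it in range.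
  induction n generalizing F with
  | zero => exact contDiff_zero.2 (ContinuousMap.continuous_postcomp f)
  | succ n ih =>
    obtain ⟨hd, hf'⟩ := contDiff_infty_iff_fderiv.1 hf
    let f' : C(E, E →L[ℝ] F) := ⟨fderiv ℝ f, hf'.continuous⟩
    refine contDiff_succ_iff_hasFDerivAt.2 ⟨fun γ => pointwiseApply K E F (f'.comp γ), ?_,
      hasFDerivAt_postcomp (f' := f') fun x => (hd x).hasFDerivAt⟩
    exact (pointwiseApply K E F).contDiff.comp (ih f' hf')

theorem contDiff_postcomp {E F : Type u} [NormedAddCommGroup E] [NormedSpace ℝ E]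
    [NormedAddCommGroup F] [NormedSpace ℝ F] (f : C(E, F)) (hf : ContDiff ℝ ∞ f) :
    ContDiff ℝ ∞ (fun η : C(K, E) => f.comp η) :=
  contDiff_infty.2 fun n => contDiff_postcomp_nat n f hf

end Nemytskii

/-! ### Local flow of a smooth vector field -/

section Flow

open MeasureTheory intervalIntegral

variable {E : Type u} [NormedAddCommGroup E] [NormedSpace ℝ E]

/-- The primitive vanishing at `0` of a continuous path on the unit interval. -/
noncomputable def pathPrimitive (E : Type u) [NormedAddCommGroup E] [NormedSpace ℝ E] :
    C(unitInterval, E) →L[ℝ] C(unitInterval, E) :=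
  LinearMap.mkContinuous
    { toFun := fun γ => ⟨fun s => ∫ r in (0 : ℝ)..s, γ (projIcc 0 1 zero_le_one r),
        (continuous_primitive (fun a b => (γ.continuous.comp
          continuous_projIcc).intervalIntegrable a b) 0).comp continuous_subtype_val⟩
      map_add' := fun γ η => by
        ext s
        exact integral_add ((γ.continuous.comp continuous_projIcc).intervalIntegrable _ _)
          ((η.continuous.comp continuous_projIcc).intervalIntegrable _ _)
      map_smul' := fun c γ => by
        ext s
        exact integral_smul c _ } 1
    (fun γ => by
      rw [one_mul]
      refine (ContinuousMap.norm_le _ (norm_nonneg _)).2 fun s => ?_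
      refine (norm_integral_le_of_norm_le_const (C := ‖γ‖)
        fun r _ => γ.norm_coe_le_norm _).trans ?_
      rw [sub_zero, abs_of_nonneg s.2.1]
      exact mul_le_of_le_one_right (norm_nonneg _) s.2.2)

theorem pathPrimitive_apply (γ : C(unitInterval, E)) (s : unitInterval) :
    pathPrimitive E γ s = ∫ r in (0 : ℝ)..s, γ (projIcc 0 1 zero_le_one r) := rfl

/-- The path `s ↦ γ (σ s)`. -/
def rescalePath (σ : unitInterval) (γ : C(unitInterval, E)) : C(unitInterval, E) :=
  γ.comp ⟨fun s => σ * s, by fun_prop⟩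

/-- The substitution r ↦ σ r. It shows that rescaling a solution path for time t gives a solution
path for time σ t. -/
theorem pathPrimitive_rescalePath (σ s : unitInterval) (γ : C(unitInterval, E)) :
    (σ : ℝ) • pathPrimitive E (rescalePath σ γ) s = pathPrimitive E γ (σ * s) := by
  rw [pathPrimitive_apply, pathPrimitive_apply]
  have h := smul_integral_comp_mul_left (a := 0) (b := (s : ℝ))
    (fun r => γ (projIcc 0 1 zero_le_one r)) (σ : ℝ)
  rw [mul_zero] at h
  rw [show (((σ * s : unitInterval)) : ℝ) = σ * s from rfl, ← h]
  congr 1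
  refine integral_congr fun r hr => ?_
  rw [uIcc_of_le s.2.1] at hr
  have hr1 : r ∈ Icc (0 : ℝ) 1 := ⟨hr.1, hr.2.trans s.2.2⟩
  have hr2 : (σ : ℝ) * r ∈ Icc (0 : ℝ) 1 := unitInterval.mul_mem σ.2 hr1
  simp only [rescalePath, ContinuousMap.comp_apply, ContinuousMap.coe_mk]
  rw [projIcc_of_mem _ hr1, projIcc_of_mem _ hr2]
  rfl

/-- The map whose zeros in the last component are the integral curves, on the time interval
`[0, t]` rescaled to the unit interval, of the vector field `f` with initial value `x`. -/
noncomputable def flowMap (f : C(E, E)) (w : (ℝ × E) × C(unitInterval, E)) :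
    (ℝ × E) × C(unitInterval, E) :=
  (w.1, w.2 - (ContinuousLinearMap.const ℝ unitInterval w.1.2
    + w.1.1 • pathPrimitive E (f.comp w.2)))

theorem contDiff_flowMap (f : C(E, E)) (hf : ContDiff ℝ ∞ f) : ContDiff ℝ ∞ (flowMap f) := by
  have h := (contDiff_postcomp (K := unitInterval) f hf).comp
    (contDiff_snd (𝕜 := ℝ) (E := ℝ × E) (F := C(unitInterval, E)))
  have h' := (pathPrimitive E).contDiff.comp h
  have hc := (ContinuousLinearMap.const (M := E) ℝ unitInterval).contDiff (n := ∞).comp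
    (contDiff_snd.comp (contDiff_fst (𝕜 := ℝ) (E := ℝ × E) (F := C(unitInterval, E))))
  exact contDiff_fst.prodMk (contDiff_snd.sub (hc.add
    ((contDiff_fst.comp contDiff_fst).smul h')))

/-- The derivative of `flowMap f` at time `0`, at a constant path. -/
noncomputable def flowMapDeriv (b : C(unitInterval, E)) :
    ((ℝ × E) × C(unitInterval, E)) ≃L[ℝ] ((ℝ × E) × C(unitInterval, E)) :=
  (ContinuousLinearEquiv.refl ℝ (ℝ × E)).skewProd (ContinuousLinearEquiv.refl ℝ _)
    (-((ContinuousLinearMap.const ℝ unitInterval).comp (ContinuousLinearMap.snd ℝ ℝ E)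
      + (ContinuousLinearMap.fst ℝ ℝ E).smulRight b))

/-- The nonlinear integral term carries the factor t, so at t = 0 its derivative in the path
vanishes. The derivative is then triangular with identity diagonal blocks, hence invertible. -/
theorem hasFDerivAt_flowMap (f : C(E, E)) (hf : ContDiff ℝ ∞ f) (x₀ : E) :
    HasFDerivAt (flowMap f)
      (flowMapDeriv (pathPrimitive E (f.comp (ContinuousLinearMap.const ℝ unitInterval x₀))) :
        ((ℝ × E) × C(unitInterval, E)) →L[ℝ] ((ℝ × E) × C(unitInterval, E)))
      ((0, x₀), ContinuousLinearMap.const ℝ unitInterval x₀) := by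
  set w₀ : (ℝ × E) × C(unitInterval, E) :=
    ((0, x₀), ContinuousLinearMap.const ℝ unitInterval x₀) with hw₀
  have h := ((contDiff_postcomp (K := unitInterval) f hf).comp
    (contDiff_snd (𝕜 := ℝ) (E := ℝ × E) (F := C(unitInterval, E))))
  have h' := (((pathPrimitive E).contDiff.comp h).differentiable (by simp) w₀).hasFDerivAt
  have hc := ((ContinuousLinearMap.const (M := E) ℝ unitInterval).comp
    ((ContinuousLinearMap.snd ℝ ℝ E).comp
      (ContinuousLinearMap.fst ℝ (ℝ × E) C(unitInterval, E)))).hasFDerivAt (x := w₀)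
  have ht := ((ContinuousLinearMap.fst ℝ ℝ E).comp
      (ContinuousLinearMap.fst ℝ (ℝ × E) C(unitInterval, E))).hasFDerivAt (x := w₀)
  have := (hasFDerivAt_fst (𝕜 := ℝ) (p := w₀)).prodMk
    ((hasFDerivAt_snd (𝕜 := ℝ) (p := w₀)).sub (hc.add (ht.smul h')))
  refine this.congr_fderiv ?_
  refine ContinuousLinearMap.ext fun v => Prod.ext rfl ?_
  simp [flowMapDeriv, hw₀, sub_eq_add_neg, Function.comp_def]

variable [CompleteSpace E]

/-- Local existence of the flow of a smooth vector field, smooth in time and initial value. -/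
theorem exists_smooth_flow (f : E → E) (hf : ContDiff ℝ ∞ f) (x₀ : E) :
    ∃ (D : Set (ℝ × E)) (Φ : ℝ × E → E), IsOpen D ∧ (0, x₀) ∈ D ∧
      (∀ t x, (t, x) ∈ D → ∀ σ ∈ Icc (0 : ℝ) 1, (σ * t, x) ∈ D) ∧
      ContDiffOn ℝ ∞ Φ D ∧ (∀ x, (0, x) ∈ D → Φ (0, x) = x) ∧
      ∀ t x, (t, x) ∈ D → HasDerivAt (fun τ => Φ (τ, x)) (f (Φ (t, x))) t := by
  let fc : C(E, E) := ⟨f, hf.continuous⟩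
  let w₀ : (ℝ × E) × C(unitInterval, E) :=
    ((0, x₀), ContinuousLinearMap.const ℝ unitInterval x₀)
  obtain ⟨Ψ₀, hw₀, -, hΨ₀, hsymm₀, -⟩ := exists_smooth_openPartialHomeomorph isOpen_univ
    (contDiff_flowMap fc hf).contDiffOn (mem_univ w₀) _ (hasFDerivAt_flowMap fc hf x₀)
  obtain ⟨r, hr, hball⟩ := Metric.isOpen_iff.1 Ψ₀.open_source w₀ hw₀
  -- On a ball, membership is a distance estimate, and shrinking the time and rescaling the path do
  -- not increase the distance to the center; an arbitrary source need not be stable under this.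
  let Ψ := Ψ₀.restrOpen (Metric.ball w₀ r) Metric.isOpen_ball
  have hΨ : ∀ w, Ψ w = flowMap fc w := fun w => congrFun hΨ₀ w
  have hsrc : ∀ w, w ∈ Ψ.source ↔ w ∈ Metric.ball w₀ r :=
    fun w => ⟨fun h => h.2, fun h => ⟨hball h, h⟩⟩
  have hsymm : ContDiffOn ℝ ∞ Ψ.symm Ψ.target := hsymm₀.mono fun y hy => hy.1
  let D : Set (ℝ × E) := {z | (z, (0 : C(unitInterval, E))) ∈ Ψ.target}
  have hDopen : IsOpen D := Ψ.open_target.preimage (by fun_prop)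
  let γ : ℝ × E → C(unitInterval, E) := fun z => (Ψ.symm (z, 0)).2
  have hfst : ∀ z ∈ D, Ψ.symm (z, 0) = (z, γ z) := by
    intro z hz
    refine Prod.ext ?_ rfl
    have h := Ψ.right_inv hz
    rw [hΨ] at h
    have h1 := congrArg Prod.fst h
    exact h1
  have hmem : ∀ z ∈ D, (z, γ z) ∈ Metric.ball w₀ r := by
    intro z hz
    have h := Ψ.map_target hz
    rw [hfst z hz] at h
    exact (hsrc _).1 h
  have heq : ∀ z ∈ D, γ z = ContinuousLinearMap.const ℝ unitInterval z.2
      + z.1 • pathPrimitive E (fc.comp (γ z)) := by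
    intro z hz
    have h := Ψ.right_inv hz
    rw [hΨ, hfst z hz] at h
    exact sub_eq_zero.1 (congrArg Prod.snd h)
  -- Injectivity of the local homeomorphism serves as the uniqueness theorem for integral curves
  -- inside the ball.
  have huniq : ∀ z η, (z, η) ∈ Metric.ball w₀ r → η = ContinuousLinearMap.const ℝ unitInterval z.2
      + z.1 • pathPrimitive E (fc.comp η) → z ∈ D ∧ γ z = η := by
    intro z η hzη h
    have h1 : Ψ (z, η) = (z, 0) := by
      rw [hΨ]
      exact Prod.ext rfl (sub_eq_zero.2 h)
    have h2 := Ψ.map_source ((hsrc _).2 hzη)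
    have h3 := Ψ.left_inv ((hsrc _).2 hzη)
    rw [h1] at h2 h3
    exact ⟨h2, congrArg Prod.snd h3⟩
  -- The path for time σ t is the rescaled path for time t, by uniqueness. Thus evaluating paths at
  -- their endpoint `1` recovers the whole curve, and the fixed-point equation becomes the integral
  -- equation for `Φ`.
  have hscale : ∀ t x, (t, x) ∈ D → ∀ σ : unitInterval,
      ((σ : ℝ) * t, x) ∈ D ∧ γ ((σ : ℝ) * t, x) = rescalePath σ (γ (t, x)) := by
    intro t x hz σ
    refine huniq _ _ ?_ ?_
    · have h := hmem _ hz
      simp only [w₀, Metric.mem_ball, Prod.dist_eq, max_lt_iff] at h ⊢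
      refine ⟨⟨?_, h.1.2⟩, ?_⟩
      · refine lt_of_le_of_lt ?_ h.1.1
        rw [Real.dist_eq, Real.dist_eq, sub_zero, sub_zero, abs_mul, abs_of_nonneg σ.2.1]
        exact mul_le_of_le_one_left (abs_nonneg _) σ.2.2
      · refine lt_of_le_of_lt ?_ h.2
        refine (ContinuousMap.dist_le dist_nonneg).2 fun s => ?_
        exact ContinuousMap.dist_apply_le_dist (f := γ (t, x))
          (g := ContinuousLinearMap.const ℝ unitInterval x₀) (σ * s)
    · ext s
      have h := congrArg (fun η : C(unitInterval, E) => η (σ * s)) (heq _ hz)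
      simp only [ContinuousMap.add_apply, ContinuousMap.smul_apply] at h ⊢
      rw [← pathPrimitive_rescalePath, smul_smul] at h
      rw [mul_comm (σ : ℝ) t]
      exact h
  let Φ : ℝ × E → E := fun z => γ z 1
  have hΦs : ∀ t x, (t, x) ∈ D → ∀ σ : unitInterval, Φ ((σ : ℝ) * t, x) = γ (t, x) σ := by
    intro t x hz σ
    simp only [Φ]
    rw [(hscale t x hz σ).2]
    simp [rescalePath]
  have hΦ : ContDiffOn ℝ ∞ Φ D := by
    have h1 : ContDiffOn ℝ ∞ γ D :=
      contDiff_snd.comp_contDiffOn (hsymm.comp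
        (contDiff_id.prodMk contDiff_const).contDiffOn (fun z hz => hz))
    exact (ContinuousMap.evalCLM ℝ (1 : unitInterval)).contDiff.comp_contDiffOn h1
  have hintegral : ∀ t x, (t, x) ∈ D → Φ (t, x) = x + ∫ τ in (0 : ℝ)..t, f (Φ (τ, x)) := by
    intro t x hz
    have h := congrArg (fun η : C(unitInterval, E) => η 1) (heq _ hz)
    refine h.trans ?_
    have h2 := smul_integral_comp_mul_left (a := 0) (b := 1) (fun τ => f (Φ (τ, x))) t
    rw [mul_zero, mul_one] at h2
    rw [← h2]
    simp only [ContinuousMap.add_apply, ContinuousMap.smul_apply, pathPrimitive_apply]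
    congr 2
    refine integral_congr fun r hr => ?_
    have hr' : r ∈ Icc (0 : ℝ) 1 := by simpa using hr
    simp only [ContinuousMap.comp_apply]
    rw [projIcc_of_mem _ hr', ← hΦs t x hz ⟨r, hr'⟩, mul_comm]
    rfl
  refine ⟨D, Φ, hDopen, ?_, fun t x hz σ hσ => (hscale t x hz ⟨σ, hσ⟩).1, hΦ, ?_, ?_⟩
  · refine (huniq (0, x₀) (ContinuousLinearMap.const ℝ unitInterval x₀)
      (Metric.mem_ball_self hr) ?_).1
    simp
  · intro x hx
    rw [hintegral 0 x hx]
    simp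
  · intro t x hz
    have hslice : IsOpen {τ : ℝ | (τ, x) ∈ D} := hDopen.preimage (by fun_prop)
    have hcont : ContinuousOn (fun τ => f (Φ (τ, x))) {τ : ℝ | (τ, x) ∈ D} :=
      hf.continuous.comp_continuousOn
        (hΦ.continuousOn.comp (Continuous.continuousOn (by fun_prop)) fun τ hτ => hτ)
    have hseg : uIcc 0 t ⊆ {τ : ℝ | (τ, x) ∈ D} := by
      intro τ hτ
      rw [← segment_eq_uIcc, segment_eq_image] at hτ
      obtain ⟨σ, hσ, rfl⟩ := hτ
      simpa using (hscale t x hz ⟨σ, hσ⟩).1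
    have hder := integral_hasDerivAt_right (hcont.mono hseg).intervalIntegrable
      (hcont.stronglyMeasurableAtFilter hslice t hz)
      (hcont.continuousAt (hslice.mem_nhds hz))
    refine (hder.const_add x).congr_of_eventuallyEq ?_
    filter_upwards [hslice.mem_nhds hz] with τ hτ
    exact hintegral τ x hτ

end Flow

/-! ### Linearization of a flow in the initial value -/

section Variation

variable {E : Type*} [NormedAddCommGroup E] [NormedSpace ℝ E]

theorem isSymmSndFDerivAt_of_smooth {F : Type*} [NormedAddCommGroup F] [NormedSpace ℝ F] {f : E → F} {x : E} (hf : ContDiffAt ℝ ∞ f x) :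
    IsSymmSndFDerivAt ℝ f x :=
  hf.isSymmSndFDerivAt (by
    simpa using (WithTop.coe_le_coe.2 le_top : ((2 : ℕ∞) : WithTop ℕ∞) ≤ ∞))

theorem hasFDerivAt_fderiv_apply {F : Type*} [NormedAddCommGroup F] [NormedSpace ℝ F] {f : E → F} {x : E} (hf : ContDiffAt ℝ ∞ f x) (v : E) :
    HasFDerivAt (fun y => fderiv ℝ f y v) ((fderiv ℝ (fderiv ℝ f) x).flip v) x :=
  (ContinuousLinearMap.apply ℝ F v).hasFDerivAt.comp x
    ((hf.fderiv_right (m := ∞) (by simp)).differentiableAt (by simp)).hasFDerivAt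

theorem eq_of_hasDerivAt_zero_uIcc {a : ℝ → ℝ} {t : ℝ}
    (ha : ∀ τ ∈ uIcc 0 t, HasDerivAt a 0 τ) : a t = a 0 := by
  have h := (convex_uIcc (0 : ℝ) t).norm_image_sub_le_of_norm_hasDerivWithin_le (f := a)
    (f' := fun _ => 0) (C := 0) (fun τ hτ => (ha τ hτ).hasDerivWithinAt) (by simp)
    left_mem_uIcc right_mem_uIcc
  rw [zero_mul, norm_le_zero_iff, sub_eq_zero] at h
  exact h

theorem uIcc_zero_subset_of_scale_mem {s : Set ℝ} {t : ℝ}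
    (hs : ∀ σ ∈ Icc (0 : ℝ) 1, σ * t ∈ s) : uIcc 0 t ⊆ s := by
  intro τ hτ
  rw [← segment_eq_uIcc, segment_eq_image] at hτ
  obtain ⟨σ, hσ, rfl⟩ := hτ
  simpa using hs σ hσ

variable {f : E → E} {D : Set (ℝ × E)} {Φ : ℝ × E → E}

theorem fderiv_flow_time (hD : IsOpen D) (hΦ : ContDiffOn ℝ ∞ Φ D)
    (hode : ∀ t x, (t, x) ∈ D → HasDerivAt (fun τ => Φ (τ, x)) (f (Φ (t, x))) t)
    {w : ℝ × E} (hw : w ∈ D) : fderiv ℝ Φ w (1, 0) = f (Φ w) := by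
  have h1 : HasFDerivAt Φ (fderiv ℝ Φ w) (w.1, w.2) :=
    ((hΦ.contDiffAt (hD.mem_nhds hw)).differentiableAt (by simp)).hasFDerivAt
  have h2 : HasDerivAt (fun τ : ℝ => (τ, w.2)) ((1 : ℝ), (0 : E)) w.1 :=
    (hasDerivAt_id _).prodMk (hasDerivAt_const _ _)
  exact (h1.comp_hasDerivAt w.1 h2).unique (hode w.1 w.2 hw)

/-- The linearized equation satisfied by the derivative of a flow in the initial value. -/
theorem hasDerivAt_fderiv_flow (hf : ContDiff ℝ ∞ f) (hD : IsOpen D) (hΦ : ContDiffOn ℝ ∞ Φ D)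
    (hode : ∀ t x, (t, x) ∈ D → HasDerivAt (fun τ => Φ (τ, x)) (f (Φ (t, x))) t)
    {t : ℝ} {x : E} (hx : (t, x) ∈ D) (v : E) :
    HasDerivAt (fun τ => fderiv ℝ Φ (τ, x) (0, v))
      (fderiv ℝ f (Φ (t, x)) (fderiv ℝ Φ (t, x) (0, v))) t := by
  have hat : ContDiffAt ℝ ∞ Φ (t, x) := hΦ.contDiffAt (hD.mem_nhds hx)
  have hline : HasDerivAt (fun τ : ℝ => (τ, x)) ((1 : ℝ), (0 : E)) t :=
    (hasDerivAt_id _).prodMk (hasDerivAt_const _ _)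
  have h1 : HasDerivAt (fun τ => fderiv ℝ Φ (τ, x) (0, v))
      (fderiv ℝ (fderiv ℝ Φ) (t, x) (1, 0) (0, v)) t :=
    HasFDerivAt.comp_hasDerivAt (f := fun τ : ℝ => (τ, x)) t
      (hasFDerivAt_fderiv_apply hat (0, v)) hline
  have h2 := hasFDerivAt_fderiv_apply hat ((1 : ℝ), (0 : E))
  have h3 : HasFDerivAt (fun w => f (Φ w))
      ((fderiv ℝ f (Φ (t, x))).comp (fderiv ℝ Φ (t, x))) (t, x) :=
    ((hf.differentiable (by simp)) _).hasFDerivAt.comp (t, x)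
      (hat.differentiableAt (by simp)).hasFDerivAt
  have h4 := h2.congr_of_eventuallyEq (f₁ := fun w => f (Φ w)) (by
    filter_upwards [hD.mem_nhds hx] with w hw
    exact (fderiv_flow_time hD hΦ hode hw).symm)
  have h5 := congrArg (fun L : ℝ × E →L[ℝ] E => L (0, v)) (h3.unique h4)
  refine h1.congr_deriv ?_
  -- Symmetry of the second derivative exchanges the time derivative with the variation of the
  -- initial value.
  rw [(isSymmSndFDerivAt_of_smooth hat).eq]
  exact h5.symm

theorem fderiv_flow_zero (hD : IsOpen D) (hΦ : ContDiffOn ℝ ∞ Φ D)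
    (hzero : ∀ x, (0, x) ∈ D → Φ (0, x) = x) {x : E} (hx : (0, x) ∈ D) (v : E) :
    fderiv ℝ Φ (0, x) (0, v) = v := by
  have h1 : HasFDerivAt Φ (fderiv ℝ Φ (0, x)) (0, x) :=
    ((hΦ.contDiffAt (hD.mem_nhds hx)).differentiableAt (by simp)).hasFDerivAt
  have h2 : HasFDerivAt (fun y : E => ((0 : ℝ), y)) (ContinuousLinearMap.inr ℝ ℝ E) x :=
    hasFDerivAt_prodMk_right 0 x
  have h3 := h1.comp x h2
  have h4 : HasFDerivAt (fun y => Φ (0, y)) (ContinuousLinearMap.id ℝ E) x :=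
    (hasFDerivAt_id x).congr_of_eventuallyEq (by
      have hs : IsOpen {y : E | ((0 : ℝ), y) ∈ D} := hD.preimage (by fun_prop)
      filter_upwards [hs.mem_nhds hx] with y hy
      exact hzero y hy)
  exact congrArg (fun L : E →L[ℝ] E => L v) (h3.unique h4)

end Variation

/-! ### Energy and action along the Hamiltonian flow -/

section HamiltonianFlow

variable {m : ℕ}

theorem fderiv_eq_sum_grad (h : PhaseSpace m → ℝ) (y v : PhaseSpace m) :
    fderiv ℝ h y v = ∑ i, gradFst h y i * v.1 i + ∑ i, gradSnd h y i * v.2 i := by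
  have hv : v = ∑ i, v.1 i • ((Pi.single i 1, 0) : PhaseSpace m)
      + ∑ i, v.2 i • ((0, Pi.single i 1) : PhaseSpace m) := by
    refine Prod.ext ?_ ?_ <;> ext j <;>
      simp [Prod.fst_sum, Prod.snd_sum, Finset.sum_apply, Pi.single_apply]
  conv_lhs => rw [hv]
  simp only [map_add, map_sum, map_smul, smul_eq_mul, gradFst, gradSnd, mul_comm]

theorem contDiff_gradFst {h : PhaseSpace m → ℝ} (hh : ContDiff ℝ ∞ h) :
    ContDiff ℝ ∞ (gradFst h) :=
  contDiff_pi.2 fun _ => (hh.fderiv_right (m := ∞) (by simp)).clm_apply contDiff_const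

theorem contDiff_gradSnd {h : PhaseSpace m → ℝ} (hh : ContDiff ℝ ∞ h) :
    ContDiff ℝ ∞ (gradSnd h) :=
  contDiff_pi.2 fun _ => (hh.fderiv_right (m := ∞) (by simp)).clm_apply contDiff_const

/-- The Hamiltonian vector field of `h`, extended by the equation `ṡ = p · ∂h/∂p` of the action. -/
noncomputable def actionField (h : PhaseSpace m → ℝ) (z : PhaseSpace m × ℝ) : PhaseSpace m × ℝ :=
  ((gradSnd h z.1, -gradFst h z.1), ∑ i, z.1.2 i * gradSnd h z.1 i)

theorem contDiff_actionField {h : PhaseSpace m → ℝ} (hh : ContDiff ℝ ∞ h) :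
    ContDiff ℝ ∞ (actionField h) := by
  have hG := (contDiff_gradSnd hh).comp (contDiff_fst (F := ℝ))
  have hF := (contDiff_gradFst hh).comp (contDiff_fst (F := ℝ))
  refine (hG.prodMk hF.neg).prodMk (ContDiff.sum fun i _ => ?_)
  exact ContDiff.mul (by fun_prop) (contDiff_pi.1 hG i)

/-- The product rule for p · ∂h/∂p, with the variation of ∂h/∂p left as the position component of
the linearized field. In this form it cancels against p · d(δx)/dt without second derivatives of h
being written out. -/
theorem fderiv_actionField_snd {h : PhaseSpace m → ℝ} (hh : ContDiff ℝ ∞ h)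
    (z u : PhaseSpace m × ℝ) :
    (fderiv ℝ (actionField h) z u).2 = ∑ i, u.1.2 i * gradSnd h z.1 i
      + ∑ i, z.1.2 i * (fderiv ℝ (actionField h) z u).1.1 i := by
  have hd : HasFDerivAt (actionField h) (fderiv ℝ (actionField h) z) z :=
    ((contDiff_actionField hh).differentiable (by simp) z).hasFDerivAt
  have h1 : ∀ i, HasFDerivAt (fun z => gradSnd h z.1 i) _ z := fun i =>
    hasFDerivAt_pi'.1 (hd.fst.fst) i
  have h2 : ∀ i, HasFDerivAt (fun z : PhaseSpace m × ℝ => z.1.2 i) _ z := fun i =>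
    hasFDerivAt_pi'.1 ((hasFDerivAt_fst (𝕜 := ℝ) (p := z)).snd) i
  have h3 := HasFDerivAt.fun_sum (u := Finset.univ) fun i _ => (h2 i).mul (h1 i)
  have h4 := congrArg (fun L : PhaseSpace m × ℝ →L[ℝ] ℝ => L u) (hd.snd.unique h3)
  simp at h4
  rw [h4, Finset.sum_add_distrib, add_comm]
  congr 1
  exact Finset.sum_congr rfl fun i _ => mul_comm _ _

variable {h : PhaseSpace m → ℝ} {D : Set (ℝ × (PhaseSpace m × ℝ))}
  {Φ : ℝ × (PhaseSpace m × ℝ) → PhaseSpace m × ℝ}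

/-- Conservation of energy. -/
theorem energy_flow (hh : ContDiff ℝ ∞ h)
    (hscale : ∀ t x, (t, x) ∈ D → ∀ σ ∈ Icc (0 : ℝ) 1, (σ * t, x) ∈ D)
    (hzero : ∀ x, (0, x) ∈ D → Φ (0, x) = x)
    (hode : ∀ t x, (t, x) ∈ D → HasDerivAt (fun τ => Φ (τ, x)) (actionField h (Φ (t, x))) t)
    {t : ℝ} {z : PhaseSpace m × ℝ} (hz : (t, z) ∈ D) : h (Φ (t, z)).1 = h z.1 := by
  have hsub : uIcc 0 t ⊆ {τ | (τ, z) ∈ D} := uIcc_zero_subset_of_scale_mem (hscale t z hz)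
  have h0 : (0, z) ∈ D := hsub left_mem_uIcc
  have key := eq_of_hasDerivAt_zero_uIcc (a := fun τ => h (Φ (τ, z)).1) (t := t) fun τ hτ => by
    have h1 := ((hh.differentiable (by simp)) (Φ (τ, z)).1).hasFDerivAt.comp_hasDerivAt τ
      (hode τ z (hsub hτ)).fst
    refine h1.congr_deriv ?_
    rw [fderiv_eq_sum_grad, ← Finset.sum_add_distrib]
    refine Finset.sum_eq_zero fun i _ => ?_
    simp [actionField]
    ring
  simpa [hzero z h0] using key

/-- The variation of the form `ds - p dx` along the flow of the action field. -/
theorem fderiv_action_flow (hh : ContDiff ℝ ∞ h) (hD : IsOpen D)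
    (hscale : ∀ t x, (t, x) ∈ D → ∀ σ ∈ Icc (0 : ℝ) 1, (σ * t, x) ∈ D)
    (hΦ : ContDiffOn ℝ ∞ Φ D) (hzero : ∀ x, (0, x) ∈ D → Φ (0, x) = x)
    (hode : ∀ t x, (t, x) ∈ D → HasDerivAt (fun τ => Φ (τ, x)) (actionField h (Φ (t, x))) t)
    {t : ℝ} {z : PhaseSpace m × ℝ} (hz : (t, z) ∈ D) (v : PhaseSpace m × ℝ) :
    (fderiv ℝ Φ (t, z) (0, v)).2
        - ∑ i, (Φ (t, z)).1.2 i * (fderiv ℝ Φ (t, z) (0, v)).1.1 i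
      = v.2 - ∑ i, z.1.2 i * v.1.1 i + t * fderiv ℝ h z.1 v.1 := by
  have hsub : uIcc 0 t ⊆ {τ | (τ, z) ∈ D} := uIcc_zero_subset_of_scale_mem (hscale t z hz)
  have h0 : (0, z) ∈ D := hsub left_mem_uIcc
  -- For a variation (δx, δp, δs), the time derivative of δs - p · δx is ∂h/∂p · δp + ∂h/∂x · δx =
  -- dh. By energy conservation this equals its initial value, so subtracting τ times that value
  -- leaves a constant.
  have key := eq_of_hasDerivAt_zero_uIcc (t := t) (a := fun τ => (fderiv ℝ Φ (τ, z) (0, v)).2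
      - ∑ i, (Φ (τ, z)).1.2 i * (fderiv ℝ Φ (τ, z) (0, v)).1.1 i - τ * fderiv ℝ h z.1 v.1)
    fun τ hτ => by
      have hτD := hsub hτ
      have hu := hasDerivAt_fderiv_flow (contDiff_actionField hh) hD hΦ hode hτD v
      have hy := hode τ z hτD
      have hen : fderiv ℝ h (Φ (τ, z)).1 (fderiv ℝ Φ (τ, z) (0, v)).1 = fderiv ℝ h z.1 v.1 := by
        have hat := ((hΦ.contDiffAt (hD.mem_nhds hτD)).differentiableAt (by simp)).hasFDerivAt
        have e1 := ((hh.differentiable (by simp)) (Φ (τ, z)).1).hasFDerivAt.comp (τ, z) hat.fst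
        have e2 := ((hh.differentiable (by simp)) z.1).hasFDerivAt.comp (τ, z)
          ((hasFDerivAt_snd (𝕜 := ℝ) (p := (τ, z))).fst)
        have e3 := e2.congr_of_eventuallyEq (f₁ := fun w => h (Φ w).1) (by
          filter_upwards [hD.mem_nhds hτD] with w hw
          exact energy_flow hh hscale hzero hode hw)
        have e4 := congrArg (fun L : ℝ × (PhaseSpace m × ℝ) →L[ℝ] ℝ => L (0, v)) (e1.unique e3)
        simpa using e4
      have hsum := HasDerivAt.fun_sum (u := Finset.univ) fun i _ =>
        (hasDerivAt_pi.1 hy.fst.snd i).mul (hasDerivAt_pi.1 hu.fst.fst i)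
      have hus : HasDerivAt (fun τ => (fderiv ℝ Φ (τ, z) (0, v)).2) _ τ := hu.snd
      refine ((hus.sub hsum).sub ((hasDerivAt_id τ).mul_const _)).congr_deriv ?_
      rw [fderiv_actionField_snd hh, ← hen, fderiv_eq_sum_grad h, Finset.sum_add_distrib]
      simp [actionField, mul_comm]
      ring
  simp only [hzero z h0, fderiv_flow_zero hD hΦ hzero h0] at key
  linarith

end HamiltonianFlow

/-! ### Characteristics of the Cauchy problem -/

section Characteristics

variable {m : ℕ} [NeZero m]

/-- The affine projection onto the hyperplane `x^1 = c` along the first coordinate axis. -/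
def setFirst (c : ℝ) (x : Fin m → ℝ) : Fin m → ℝ := x + (c - x 0) • Pi.single 0 1

theorem setFirst_zero (c : ℝ) (x : Fin m → ℝ) : setFirst c x 0 = c := by simp [setFirst]

theorem setFirst_of_ne (c : ℝ) (x : Fin m → ℝ) {k : Fin m} (hk : k ≠ 0) :
    setFirst c x k = x k := by simp [setFirst, hk]

theorem setFirst_eq_self {c : ℝ} {x : Fin m → ℝ} (hx : x 0 = c) : setFirst c x = x := by
  simp [setFirst, hx]

theorem contDiff_setFirst (c : ℝ) : ContDiff ℝ ∞ (setFirst (m := m) c) := by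
  unfold setFirst
  fun_prop

theorem fderiv_setFirst (c : ℝ) (x v : Fin m → ℝ) :
    fderiv ℝ (setFirst c) x v = setFirst 0 v := by
  have h0 : HasFDerivAt (fun x : Fin m → ℝ => x 0) (ContinuousLinearMap.proj 0) x :=
    (ContinuousLinearMap.proj (R := ℝ) (φ := fun _ : Fin m => ℝ) 0).hasFDerivAt
  have h := (hasFDerivAt_id (𝕜 := ℝ) x).add ((h0.const_sub c).smul_const (Pi.single (0 : Fin m) (1 : ℝ)))
  have h' : HasFDerivAt (setFirst c) _ x := h
  rw [h'.fderiv]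
  simp [setFirst]

/-- The change of variables replacing the momentum `p_1` by the energy `h`. -/
def energyMap (h : PhaseSpace m → ℝ) (y : PhaseSpace m) : PhaseSpace m :=
  (y.1, setFirst (h y) y.2)

theorem contDiff_energyMap {h : PhaseSpace m → ℝ} (hh : ContDiff ℝ ∞ h) :
    ContDiff ℝ ∞ (energyMap h) := by
  unfold energyMap setFirst
  fun_prop

theorem fderiv_energyMap {h : PhaseSpace m → ℝ} (hh : ContDiff ℝ ∞ h) (y v : PhaseSpace m) :
    fderiv ℝ (energyMap h) y v = (v.1, setFirst (fderiv ℝ h y v) v.2) := by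
  have h0 : HasFDerivAt (fun y : PhaseSpace m => y.2 0)
      ((ContinuousLinearMap.proj 0).comp (ContinuousLinearMap.snd ℝ (Fin m → ℝ) (Fin m → ℝ))) y :=
    ((ContinuousLinearMap.proj 0).comp
      (ContinuousLinearMap.snd ℝ (Fin m → ℝ) (Fin m → ℝ))).hasFDerivAt
  have hd := ((hh.differentiable (by simp)) y).hasFDerivAt
  have h2 := (hasFDerivAt_fst (𝕜 := ℝ) (p := y)).prodMk ((hasFDerivAt_snd (𝕜 := ℝ) (p := y)).add
    ((hd.sub h0).smul_const (Pi.single (0 : Fin m) (1 : ℝ))))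
  have h' : HasFDerivAt (energyMap h) _ y := h2
  rw [h'.fderiv]
  rfl

/-- On a kernel vector all components other than δp_1 vanish, and then dh = ∂h/∂p_1 δp_1 = 0 forces
δp_1 = 0. -/
theorem injective_fderiv_energyMap {h : PhaseSpace m → ℝ} (hh : ContDiff ℝ ∞ h)
    {y : PhaseSpace m} (hp : gradSnd h y 0 ≠ 0) : Function.Injective (fderiv ℝ (energyMap h) y) := by
  rw [injective_iff_map_eq_zero]
  intro v hv
  rw [fderiv_energyMap hh, Prod.mk_eq_zero] at hv
  obtain ⟨hv1, hv2⟩ := hv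
  have hk : ∀ k ≠ 0, v.2 k = 0 := fun k hk => by
    rw [← setFirst_of_ne (fderiv ℝ h y v) v.2 hk, hv2]
    rfl
  have h0 : fderiv ℝ h y v = 0 := by
    rw [← setFirst_zero (m := m) (fderiv ℝ h y v) v.2, hv2]
    rfl
  rw [fderiv_eq_sum_grad, Finset.sum_eq_zero (fun i _ => by simp [hv1]), zero_add,
    Finset.sum_eq_single 0 (fun k _ h => by simp [hk k h]) (by simp)] at h0
  have h00 : v.2 0 = 0 := (mul_eq_zero.1 h0).resolve_left hp
  refine Prod.ext hv1 (funext fun k => ?_)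
  by_cases hk0 : k = 0
  · rw [hk0]
    exact h00
  · exact hk k hk0

/-- A smooth family of solutions of the characteristic system of the Cauchy problem. The parameter
`w = (q, X)` stands for the characteristic issued at time `0` from the point of the initial
hyperplane `x^1 = c` with coordinates `q^2, …, q^m`, taken at time `q^1 - c`, for the values `X` of
the parameters of the Cauchy problem. The value `Γ w = ((x, p), s)` contains the position, the
momentum, and the value of the solution. -/
structure IsCharacteristicFamily (h : PhaseSpace m → ℝ) (c : ℝ) (O : Set (PhaseSpace m))
    (Γ : PhaseSpace m → PhaseSpace m × ℝ) : Prop where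
  isOpen : IsOpen O
  smooth : ContDiffOn ℝ ∞ Γ O
  form : ∀ w ∈ O, ∀ v : PhaseSpace m, (fderiv ℝ Γ w v).2 =
    ∑ i, (Γ w).1.2 i * (fderiv ℝ Γ w v).1.1 i + ∑ i, (w.1 i - (Pi.single 0 c : Fin m → ℝ) i) * v.2 i
  energy : ∀ w ∈ O, h (Γ w).1 = w.2 0
  initial_position : ∀ w ∈ O, w.1 0 = c → (Γ w).1.1 = w.1
  initial_value : ∀ w ∈ O, w.1 0 = c →
    (Γ w).2 = ∑ k ∈ Finset.univ.erase (0 : Fin m), w.1 k * w.2 k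

/-- Locally inverting `energyMap h` solves h = X^1 for p_1, with the position projected to the
initial hyperplane and p_k = X^k for k ≥ 2. The result `A w` is the initial point of the
characteristic with parameter `w`. -/
theorem exists_initial_data {h : PhaseSpace m → ℝ} (hh : ContDiff ℝ ∞ h) {y₀ : PhaseSpace m}
    (hp : gradSnd h y₀ 0 ≠ 0) :
    ∃ (O : Set (PhaseSpace m)) (A : PhaseSpace m → PhaseSpace m), IsOpen O ∧ energyMap h y₀ ∈ O ∧
      ContDiffOn ℝ ∞ A O ∧ A (energyMap h y₀) = y₀ ∧
      ∀ w ∈ O, energyMap h (A w) = (setFirst (y₀.1 0) w.1, w.2) := by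
  obtain ⟨K, hK, -, hKe, hKs, -⟩ := exists_smooth_openPartialHomeomorph_of_injective isOpen_univ
    (contDiff_energyMap hh).contDiffOn (mem_univ y₀) (injective_fderiv_energyMap hh hp)
  let g : PhaseSpace m → PhaseSpace m := fun w => (setFirst (y₀.1 0) w.1, w.2)
  have hg : ContDiff ℝ ∞ g :=
    ((contDiff_setFirst _).comp contDiff_fst).prodMk contDiff_snd
  have hg0 : g (energyMap h y₀) = K y₀ := by
    rw [hKe]
    exact Prod.ext (setFirst_eq_self rfl) rfl
  refine ⟨g ⁻¹' K.target, fun w => K.symm (g w), K.open_target.preimage hg.continuous, ?_,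
    hKs.comp hg.contDiffOn fun w hw => hw, ?_, fun w hw => ?_⟩
  · rw [mem_preimage, hg0]
    exact K.map_source hK
  · simp only [hg0]
    exact K.left_inv hK
  · rw [← hKe]
    exact K.right_inv hw

theorem sum_eq_zero_add_sum_erase (f : Fin m → ℝ) :
    ∑ i, f i = f 0 + ∑ k ∈ Finset.univ.erase (0 : Fin m), f k :=
  (Finset.add_sum_erase _ _ (Finset.mem_univ 0)).symm

/-- The family is the action flow at time q^1 - c applied to the initial data. The last two clauses
are what the inverse function theorem needs for (q, X) ↦ (x, X) and (q, X) ↦ (x, p); they hold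
because ẋ^1 = ∂h/∂p_1 ≠ 0 makes the flow transverse to the initial hyperplane. -/
theorem exists_characteristicFamily {h : PhaseSpace m → ℝ} (hh : ContDiff ℝ ∞ h)
    {y₀ : PhaseSpace m} (hp : gradSnd h y₀ 0 ≠ 0) :
    ∃ (O : Set (PhaseSpace m)) (Γ : PhaseSpace m → PhaseSpace m × ℝ),
      IsCharacteristicFamily h (y₀.1 0) O Γ ∧ energyMap h y₀ ∈ O ∧ (Γ (energyMap h y₀)).1 = y₀ ∧
      (∀ v, (fderiv ℝ Γ (energyMap h y₀) v).1.1 = 0 → v.1 = 0) ∧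
      (∀ v, (fderiv ℝ Γ (energyMap h y₀) v).1 = 0 → v = 0) := by
  set c := y₀.1 0 with hc
  set w₀ := energyMap h y₀ with hw₀
  obtain ⟨O₁, A, hO₁, hw₀O₁, hA, hAw₀, hKA⟩ := exists_initial_data hh hp
  have hA1 : ∀ w ∈ O₁, (A w).1 = setFirst c w.1 := fun w hw => congrArg Prod.fst (hKA w hw)
  have hA2 : ∀ w ∈ O₁, ∀ k ≠ 0, (A w).2 k = w.2 k := fun w hw k hk => by
    have : setFirst (h (A w)) (A w).2 k = w.2 k := congrFun (congrArg Prod.snd (hKA w hw)) k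
    rwa [setFirst_of_ne _ _ hk] at this
  have hAh : ∀ w ∈ O₁, h (A w) = w.2 0 := fun w hw => by
    have : setFirst (h (A w)) (A w).2 0 = w.2 0 := congrFun (congrArg Prod.snd (hKA w hw)) 0
    rwa [setFirst_zero] at this
  let s₀ : PhaseSpace m → ℝ := fun w => ∑ k ∈ Finset.univ.erase (0 : Fin m), w.1 k * w.2 k
  have hs₀ : ContDiff ℝ ∞ s₀ := by
    simp only [s₀]
    fun_prop
  have hs₀' : ∀ w v : PhaseSpace m, fderiv ℝ s₀ w v =
      ∑ k ∈ Finset.univ.erase (0 : Fin m), (w.1 k * v.2 k + w.2 k * v.1 k) := by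
    intro w v
    have h1 : ∀ k : Fin m, HasFDerivAt (fun w : PhaseSpace m => w.1 k) ((ContinuousLinearMap.proj k).comp
        (ContinuousLinearMap.fst ℝ (Fin m → ℝ) (Fin m → ℝ))) w := fun k =>
      ((ContinuousLinearMap.proj k).comp
        (ContinuousLinearMap.fst ℝ (Fin m → ℝ) (Fin m → ℝ))).hasFDerivAt
    have h2 : ∀ k : Fin m, HasFDerivAt (fun w : PhaseSpace m => w.2 k) ((ContinuousLinearMap.proj k).comp
        (ContinuousLinearMap.snd ℝ (Fin m → ℝ) (Fin m → ℝ))) w := fun k =>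
      ((ContinuousLinearMap.proj k).comp
        (ContinuousLinearMap.snd ℝ (Fin m → ℝ) (Fin m → ℝ))).hasFDerivAt
    have h3 : HasFDerivAt s₀ _ w :=
      HasFDerivAt.fun_sum (u := Finset.univ.erase (0 : Fin m)) fun k _ => (h1 k).mul (h2 k)
    rw [h3.fderiv]
    simp
  let B : PhaseSpace m → PhaseSpace m × ℝ := fun w => (A w, s₀ w)
  have hB : ContDiffOn ℝ ∞ B O₁ := hA.prodMk hs₀.contDiffOn
  have hBd : ∀ w ∈ O₁, HasFDerivAt B (fderiv ℝ B w) w := fun w hw =>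
    ((hB.contDiffAt (hO₁.mem_nhds hw)).differentiableAt (by simp)).hasFDerivAt
  have hB2 : ∀ w ∈ O₁, ∀ v, (fderiv ℝ B w v).2 =
      ∑ k ∈ Finset.univ.erase (0 : Fin m), (w.1 k * v.2 k + w.2 k * v.1 k) := by
    intro w hw v
    rw [← hs₀' w v, (hBd w hw).snd.fderiv]
    rfl
  have hBK : ∀ w ∈ O₁, ∀ v, ((fderiv ℝ B w v).1.1,
      setFirst (fderiv ℝ h (A w) (fderiv ℝ B w v).1) (fderiv ℝ B w v).1.2)
        = (setFirst 0 v.1, v.2) := by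
    intro w hw v
    have e1 := ((contDiff_energyMap hh).differentiable (by simp) (A w)).hasFDerivAt.comp w
      (hBd w hw).fst
    have e2 : HasFDerivAt (fun w : PhaseSpace m => (setFirst c w.1, w.2)) _ w :=
      (((contDiff_setFirst c).differentiable (by simp) w.1).hasFDerivAt.comp w
        (hasFDerivAt_fst (𝕜 := ℝ) (p := w))).prodMk (hasFDerivAt_snd (𝕜 := ℝ) (p := w))
    have e3 := e2.congr_of_eventuallyEq (f₁ := fun w => energyMap h (A w)) (by
      filter_upwards [hO₁.mem_nhds hw] with w hw
      exact hKA w hw)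
    have e4 := congrArg (fun L : PhaseSpace m →L[ℝ] PhaseSpace m => L v) (e1.unique e3)
    rw [← fderiv_setFirst c w.1 v.1, ← fderiv_energyMap hh]
    exact e4
  have hB1 : ∀ w ∈ O₁, ∀ v, (fderiv ℝ B w v).1.1 = setFirst 0 v.1 :=
    fun w hw v => congrArg Prod.fst (hBK w hw v)
  have hBh : ∀ w ∈ O₁, ∀ v, fderiv ℝ h (A w) (fderiv ℝ B w v).1 = v.2 0 := fun w hw v => by
    have : setFirst _ _ 0 = v.2 0 := congrFun (congrArg Prod.snd (hBK w hw v)) 0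
    rwa [setFirst_zero] at this
  obtain ⟨D, Φ, hD, hzD, hscale, hΦ, hzero, hode⟩ :=
    exists_smooth_flow (actionField h) (contDiff_actionField hh) (B w₀)
  let ρ : PhaseSpace m → ℝ × (PhaseSpace m × ℝ) := fun w => (w.1 0 - c, B w)
  have hρ : ContDiffOn ℝ ∞ ρ O₁ := ContDiffOn.prodMk (by fun_prop) hB
  have hρd : ∀ w ∈ O₁, HasFDerivAt ρ (((ContinuousLinearMap.proj 0).comp
        (ContinuousLinearMap.fst ℝ (Fin m → ℝ) (Fin m → ℝ))).prod (fderiv ℝ B w)) w := fun w hw =>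
    (((ContinuousLinearMap.proj 0).comp
        (ContinuousLinearMap.fst ℝ (Fin m → ℝ) (Fin m → ℝ))).hasFDerivAt.sub_const c).prodMk
      (hBd w hw)
  let O := O₁ ∩ ρ ⁻¹' D
  have hO : IsOpen O := hρ.continuousOn.isOpen_inter_preimage hO₁ hD
  let Γ : PhaseSpace m → PhaseSpace m × ℝ := fun w => Φ (ρ w)
  have hΓ : ContDiffOn ℝ ∞ Γ O :=
    hΦ.comp (hρ.mono inter_subset_left) fun w hw => hw.2
  have hΓd : ∀ w ∈ O, ∀ v, fderiv ℝ Γ w v =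
      v.1 0 • actionField h (Γ w) + fderiv ℝ Φ (ρ w) (0, fderiv ℝ B w v) := by
    intro w hw v
    have e1 : HasFDerivAt Γ _ w :=
      ((hΦ.contDiffAt (hD.mem_nhds hw.2)).differentiableAt (by simp)).hasFDerivAt.comp w
        (hρd w hw.1)
    rw [e1.fderiv, ← fderiv_flow_time hD hΦ hode hw.2, ← map_smul, ← map_add]
    simp
  have hρ0 : ∀ w, w.1 0 = c → ρ w = (0, B w) := fun w hw => by simp [ρ, hw]
  have hw₀c : w₀.1 0 = c := rfl
  have hw₀O : w₀ ∈ O := ⟨hw₀O₁, by rw [mem_preimage, hρ0 _ hw₀c]; exact hzD⟩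
  have hΓ0 : ∀ w ∈ O, w.1 0 = c → Γ w = B w := fun w hw hwc => by
    have := hw.2
    simp only [Γ]
    rw [mem_preimage, hρ0 w hwc] at this
    rw [hρ0 w hwc]
    exact hzero _ this
  have hΓw₀ : (Γ w₀).1 = y₀ := by rw [hΓ0 w₀ hw₀O hw₀c]; exact hAw₀
  have hΓdw₀ : ∀ v, fderiv ℝ Γ w₀ v = v.1 0 • actionField h (Γ w₀) + fderiv ℝ B w₀ v := fun v => by
    rw [hΓd w₀ hw₀O v, hρ0 w₀ hw₀c]
    congr 1
    exact fderiv_flow_zero hD hΦ hzero hzD _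
  have hinj : ∀ v, (fderiv ℝ Γ w₀ v).1.1 = 0 → v.1 = 0 := by
    intro v hv
    rw [hΓdw₀] at hv
    have e : ∀ k, v.1 0 * gradSnd h y₀ k + setFirst 0 v.1 k = 0 := fun k => by
      have := congrFun hv k
      simp only [Prod.fst_add, Prod.smul_fst, Pi.add_apply, Pi.smul_apply, hB1 w₀ hw₀O₁ v,
        actionField, hΓw₀] at this
      exact this
    have h0 : v.1 0 = 0 := by
      have := e 0
      rw [setFirst_zero, add_zero] at this
      exact (mul_eq_zero.1 this).resolve_right hp
    funext k
    have := e k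
    rw [h0, zero_mul, zero_add, setFirst_eq_self h0] at this
    exact this
  refine ⟨O, Γ, ⟨hO, hΓ, ?_, ?_, ?_, ?_⟩, hw₀O, hΓw₀, hinj, ?_⟩
  · intro w hw v
    -- At time `0` the form ds - p dx equals ∑_{k ≥ 2} q^k dX^k, and dh = dX^1 contributes (q^1 - c)
    -- dX^1 along the flow. The variation of the time itself adds nothing, since ṡ = p · ẋ.
    have key := fderiv_action_flow hh hD hscale hΦ hzero hode (t := w.1 0 - c) (z := B w)
      hw.2 (fderiv ℝ B w v)
    rw [hBh w hw.1, hB2 w hw.1, hB1 w hw.1] at key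
    have hsum : ∑ i, (B w).1.2 i * setFirst 0 v.1 i
        = ∑ k ∈ Finset.univ.erase (0 : Fin m), w.2 k * v.1 k := by
      rw [sum_eq_zero_add_sum_erase, setFirst_zero, mul_zero, zero_add]
      refine Finset.sum_congr rfl fun k hk => ?_
      have hk := Finset.ne_of_mem_erase hk
      rw [setFirst_of_ne _ _ hk]
      congr 1
      exact hA2 w hw.1 k hk
    rw [hsum, Finset.sum_add_distrib] at key
    have hQ : ∑ i, (w.1 i - (Pi.single 0 c : Fin m → ℝ) i) * v.2 i = (w.1 0 - c) * v.2 0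
        + ∑ k ∈ Finset.univ.erase (0 : Fin m), w.1 k * v.2 k := by
      rw [sum_eq_zero_add_sum_erase]
      exact congrArg₂ (· + ·) (by simp)
        (Finset.sum_congr rfl fun k hk => by simp [Finset.ne_of_mem_erase hk])
    rw [hQ, hΓd w hw v]
    simp only [Prod.snd_add, Prod.fst_add, Prod.smul_fst, Prod.smul_snd, Pi.add_apply,
      Pi.smul_apply, smul_eq_mul, mul_add, Finset.sum_add_distrib, actionField]
    have e1 : ∑ i, (Γ w).1.2 i * (v.1 0 * gradSnd h (Γ w).1 i)
        = v.1 0 * ∑ i, (Γ w).1.2 i * gradSnd h (Γ w).1 i := by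
      rw [Finset.mul_sum]
      exact Finset.sum_congr rfl fun i _ => by ring
    rw [e1]
    have e2 : Φ (w.1 0 - c, B w) = Γ w := rfl
    have e3 : (w.1 0 - c, B w) = ρ w := rfl
    rw [e2, e3] at key
    linarith
  · intro w hw
    rw [← hAh w hw.1]
    exact energy_flow hh hscale hzero hode hw.2
  · intro w hw hwc
    rw [hΓ0 w hw hwc]
    exact (hA1 w hw.1).trans (setFirst_eq_self hwc)
  · intro w hw hwc
    rw [hΓ0 w hw hwc]
  · intro v hv
    -- Once δq = 0 only the variation of the initial point remains, and `energyMap h` recovers X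
    -- from that point, so δX = 0 too.
    have hv1 := hinj v (by rw [hv]; rfl)
    rw [hΓdw₀, hv1] at hv
    have hv2 : (fderiv ℝ B w₀ v).1 = 0 := by simpa using hv
    have := congrArg Prod.snd (hBK w₀ hw₀O₁ v)
    rw [hv2] at this
    refine Prod.ext hv1 (this.symm.trans ?_)
    simp [setFirst]

end Characteristics

/-! ### The symplectic form in the parameters of the characteristics -/

section Symplectic

variable {m : ℕ}

/-- The standard symplectic form `dp_i ∧ dx^i` of the phase space. -/
def stdForm (u v : PhaseSpace m) : ℝ := ∑ i, (u.2 i * v.1 i - v.2 i * u.1 i)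

variable [NeZero m] {h : PhaseSpace m → ℝ} {c : ℝ} {O : Set (PhaseSpace m)}
  {Γ : PhaseSpace m → PhaseSpace m × ℝ}

theorem IsCharacteristicFamily.contDiffAt (H : IsCharacteristicFamily h c O Γ) {w : PhaseSpace m}
    (hw : w ∈ O) : ContDiffAt ℝ ∞ Γ w :=
  H.smooth.contDiffAt (H.isOpen.mem_nhds hw)

theorem IsCharacteristicFamily.hasFDerivAt (H : IsCharacteristicFamily h c O Γ) {w : PhaseSpace m}
    (hw : w ∈ O) : HasFDerivAt Γ (fderiv ℝ Γ w) w :=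
  ((H.contDiffAt hw).differentiableAt (by simp)).hasFDerivAt

/-- The identity ds = p dx + (q - c e₁) dX in direction `v`, differentiated once more in direction
`u`. -/
theorem IsCharacteristicFamily.second_variation (H : IsCharacteristicFamily h c O Γ)
    {w : PhaseSpace m} (hw : w ∈ O) (u v : PhaseSpace m) :
    (fderiv ℝ (fderiv ℝ Γ) w u v).2
      = ∑ i, (fderiv ℝ Γ w u).1.2 i * (fderiv ℝ Γ w v).1.1 i
        + ∑ i, (Γ w).1.2 i * (fderiv ℝ (fderiv ℝ Γ) w u v).1.1 i + ∑ i, u.1 i * v.2 i := by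
  have hd := hasFDerivAt_fderiv_apply (H.contDiffAt hw) v
  have h1 : ∀ i, HasFDerivAt (fun w => (fderiv ℝ Γ w v).1.1 i) _ w :=
    fun i => hasFDerivAt_pi'.1 hd.fst.fst i
  have h2 : ∀ i, HasFDerivAt (fun w => (Γ w).1.2 i) _ w :=
    fun i => hasFDerivAt_pi'.1 (H.hasFDerivAt hw).fst.snd i
  have h3 : ∀ i : Fin m, HasFDerivAt (fun w : PhaseSpace m => w.1 i) ((ContinuousLinearMap.proj i).comp
      (ContinuousLinearMap.fst ℝ (Fin m → ℝ) (Fin m → ℝ))) w := fun i =>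
    ((ContinuousLinearMap.proj i).comp
      (ContinuousLinearMap.fst ℝ (Fin m → ℝ) (Fin m → ℝ))).hasFDerivAt
  have h4 := (HasFDerivAt.fun_sum (u := Finset.univ) fun i _ => (h2 i).mul (h1 i)).add
    (HasFDerivAt.fun_sum (u := Finset.univ) fun i _ =>
      ((h3 i).sub_const ((Pi.single 0 c : Fin m → ℝ) i)).mul_const (v.2 i))
  have h5 : HasFDerivAt (fun w => (fderiv ℝ Γ w v).2) _ w := hd.snd
  have h6 := h4.congr_of_eventuallyEq (f₁ := fun w => (fderiv ℝ Γ w v).2) (by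
    filter_upwards [H.isOpen.mem_nhds hw] with w hw
    exact H.form w hw v)
  have h7 := congrArg (fun L : PhaseSpace m →L[ℝ] ℝ => L u) (h5.unique h6)
  simp at h7
  rw [h7, Finset.sum_add_distrib, add_comm (∑ i, (Γ w).1.2 i * _)]
  refine congrArg₂ (· + ·) (congrArg₂ (· + ·) ?_ rfl) ?_ <;>
    exact Finset.sum_congr rfl fun i _ => mul_comm _ _

/-- This is d(ds) = 0, that is dp ∧ dx = dX ∧ dq: antisymmetrizing the second variation removes the
second derivatives of s and x by symmetry. -/
theorem IsCharacteristicFamily.stdForm_fderiv (H : IsCharacteristicFamily h c O Γ)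
    {w : PhaseSpace m} (hw : w ∈ O) (u v : PhaseSpace m) :
    stdForm (fderiv ℝ Γ w u).1 (fderiv ℝ Γ w v).1 = ∑ i, (u.2 i * v.1 i - v.2 i * u.1 i) := by
  have h1 := H.second_variation hw u v
  have h2 := H.second_variation hw v u
  rw [(isSymmSndFDerivAt_of_smooth (H.contDiffAt hw)).eq v u] at h2
  rw [stdForm, Finset.sum_sub_distrib, Finset.sum_sub_distrib]
  simp only [mul_comm (u.2 _), mul_comm (v.2 _)]
  linarith

end Symplectic

/-! ### Generating function and new coordinates in phase space -/

section Straightening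

variable {m : ℕ} [NeZero m]

/-- The affine change of variables `(q, X) ↦ (X, c e₁ - q)`. -/
def parameterMap (c : ℝ) : PhaseSpace m ≃ₜ PhaseSpace m where
  toFun w := (w.2, Pi.single 0 c - w.1)
  invFun y := (Pi.single 0 c - y.2, y.1)
  left_inv w := by simp
  right_inv y := by simp
  continuous_toFun := by fun_prop
  continuous_invFun := by fun_prop

theorem contDiff_parameterMap (c : ℝ) : ContDiff ℝ ∞ (parameterMap (m := m) c) := by
  change ContDiff ℝ ∞ fun w : PhaseSpace m => (w.2, Pi.single 0 c - w.1)
  fun_prop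

theorem contDiff_parameterMap_symm (c : ℝ) : ContDiff ℝ ∞ (parameterMap (m := m) c).symm := by
  change ContDiff ℝ ∞ fun y : PhaseSpace m => (Pi.single 0 c - y.2, y.1)
  fun_prop

theorem fderiv_parameterMap (c : ℝ) (w v : PhaseSpace m) :
    fderiv ℝ (parameterMap c) w v = (v.2, -v.1) := by
  have h1 : HasFDerivAt (parameterMap c) _ w := (hasFDerivAt_snd (𝕜 := ℝ) (p := w)).prodMk
    ((hasFDerivAt_fst (𝕜 := ℝ) (p := w)).const_sub (Pi.single (0 : Fin m) c))
  rw [h1.fderiv]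
  rfl

/-- A local solution of the straightening problem in the phase space. -/
theorem exists_euclidean_straightening {h : PhaseSpace m → ℝ} (hh : ContDiff ℝ ∞ h)
    {D : Set (PhaseSpace m)} (hD : IsOpen D) {y₀ : PhaseSpace m} (hy₀ : y₀ ∈ D)
    (hp : gradSnd h y₀ 0 ≠ 0) :
    ∃ (Z : OpenPartialHomeomorph (PhaseSpace m) (PhaseSpace m)) (W : Set (PhaseSpace m))
      (S : PhaseSpace m → ℝ), y₀ ∈ Z.source ∧ Z.source ⊆ D ∧ ContDiffOn ℝ ∞ Z Z.source ∧
      ContDiffOn ℝ ∞ Z.symm Z.target ∧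
      (∀ y ∈ Z.source, ∀ a b, stdForm (fderiv ℝ Z y a) (fderiv ℝ Z y b) = stdForm a b) ∧
      (∀ y ∈ Z.source, h y = (Z y).1 0) ∧
      IsGeneratingFunction (OpenPartialHomeomorph.refl _) Z W S ∧
      (∀ w ∈ W, (w.1, gradFst S w) ∈ D) ∧
      SolvesCauchyProblem (OpenPartialHomeomorph.refl _) h (y₀.1 0) W S := by
  obtain ⟨O₀, Γ, H₀, hw₀O₀, hΓw₀, hinj1, hinj2⟩ := exists_characteristicFamily hh hp
  set c := y₀.1 0 with hc
  set w₀ := energyMap h y₀ with hw₀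
  let O : Set (PhaseSpace m) := O₀ ∩ (fun w => (Γ w).1) ⁻¹' D
  have hO : IsOpen O :=
    (continuous_fst.comp_continuousOn H₀.smooth.continuousOn).isOpen_inter_preimage H₀.isOpen hD
  have hw₀O : w₀ ∈ O := ⟨hw₀O₀, by rw [mem_preimage, hΓw₀]; exact hy₀⟩
  have hΓd : ∀ w ∈ O, HasFDerivAt Γ (fderiv ℝ Γ w) w := fun w hw => H₀.hasFDerivAt hw.1
  have hΓs : ContDiffOn ℝ ∞ Γ O := H₀.smooth.mono inter_subset_left
  -- the map from the parameters to `(x, X)`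
  let F : PhaseSpace m → PhaseSpace m := fun w => ((Γ w).1.1, w.2)
  have hF : ContDiffOn ℝ ∞ F O :=
    (contDiff_fst.comp_contDiffOn (contDiff_fst.comp_contDiffOn hΓs)).prodMk
      contDiff_snd.contDiffOn
  have hFd : ∀ w ∈ O, ∀ v, fderiv ℝ F w v = ((fderiv ℝ Γ w v).1.1, v.2) := fun w hw v => by
    have h1 : HasFDerivAt F _ w :=
      (hΓd w hw).fst.fst.prodMk (hasFDerivAt_snd (𝕜 := ℝ) (p := w))
    rw [h1.fderiv]
    rfl
  have hFi : Function.Injective (fderiv ℝ F w₀) := by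
    rw [injective_iff_map_eq_zero]
    intro v hv
    rw [hFd w₀ hw₀O, Prod.mk_eq_zero] at hv
    exact Prod.ext (hinj1 v hv.1) hv.2
  obtain ⟨Fh, hFw₀, hFsub, hFe, hFsymm, hFinj⟩ :=
    exists_smooth_openPartialHomeomorph_of_injective hO hF hw₀O hFi
  -- the map from the parameters to `(x, p)`
  let Θ : PhaseSpace m → PhaseSpace m := fun w => (Γ w).1
  have hΘ : ContDiffOn ℝ ∞ Θ O := contDiff_fst.comp_contDiffOn hΓs
  have hΘd : ∀ w ∈ O, ∀ v, fderiv ℝ Θ w v = (fderiv ℝ Γ w v).1 := fun w hw v => by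
    have h1 : HasFDerivAt Θ _ w := (hΓd w hw).fst
    rw [h1.fderiv]
    rfl
  have hΘi : Function.Injective (fderiv ℝ Θ w₀) := by
    rw [injective_iff_map_eq_zero]
    intro v hv
    rw [hΘd w₀ hw₀O] at hv
    exact hinj2 v hv
  obtain ⟨Θh, hΘw₀, hΘsub, hΘe, hΘsymm, -⟩ :=
    exists_smooth_openPartialHomeomorph_of_injective hO hΘ hw₀O hΘi
  -- the generating function
  let S : PhaseSpace m → ℝ := fun y => (Γ (Fh.symm y)).2
  have hS : ContDiffOn ℝ ∞ S Fh.target :=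
    contDiff_snd.comp_contDiffOn (hΓs.comp hFsymm fun y hy => hFsub (Fh.map_target hy))
  have hFr : ∀ y ∈ Fh.target, (Γ (Fh.symm y)).1.1 = y.1 ∧ (Fh.symm y).2 = y.2 := by
    intro y hy
    have h1 : ((Γ (Fh.symm y)).1.1, (Fh.symm y).2) = y := by
      have := Fh.right_inv hy
      rwa [hFe] at this
    exact Prod.ext_iff.1 h1
  -- Since S ∘ F = s, the differential of S is known on the image of dF. Injectivity of dF gives
  -- surjectivity in finite dimension, so this is every direction, and the `form` identity reads dS
  -- = p dx + (q - c e₁) dX.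
  have hSd : ∀ y ∈ Fh.target, ∀ u, fderiv ℝ S y u =
      ∑ i, (Γ (Fh.symm y)).1.2 i * u.1 i
        + ∑ i, ((Fh.symm y).1 i - (Pi.single 0 c : Fin m → ℝ) i) * u.2 i := by
    intro y hy u
    set w := Fh.symm y with hw
    have hws : w ∈ Fh.source := Fh.map_target hy
    have hwO : w ∈ O := hFsub hws
    have hFw : F w = y := by
      rw [← hFe]
      exact Fh.right_inv hy
    obtain ⟨v, rfl⟩ := (LinearMap.injective_iff_surjective
      (f := (fderiv ℝ F w).toLinearMap)).1 (hFinj w hws) u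
    have e1 : HasFDerivAt S (fderiv ℝ S y) (F w) := by
      rw [hFw]
      exact ((hS.contDiffAt (Fh.open_target.mem_nhds hy)).differentiableAt (by simp)).hasFDerivAt
    have e2 := e1.comp w
      ((hF.contDiffAt (hO.mem_nhds hwO)).differentiableAt (by simp)).hasFDerivAt
    have e3 : HasFDerivAt (fun w => (Γ w).2) _ w := (hΓd w hwO).snd
    have e4 := e3.congr_of_eventuallyEq (f₁ := fun w => S (F w)) (by
      filter_upwards [Fh.open_source.mem_nhds hws] with w' hw'
      simp only [S]
      rw [← hFe, Fh.left_inv hw'])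
    have e5 := congrArg (fun L : PhaseSpace m →L[ℝ] ℝ => L v) (e2.unique e4)
    refine Eq.trans e5 ((H₀.form w hwO.1 v).trans ?_)
    change _ = ∑ i, (Γ w).1.2 i * (fderiv ℝ F w v).1 i
      + ∑ i, (w.1 i - (Pi.single 0 c : Fin m → ℝ) i) * (fderiv ℝ F w v).2 i
    rw [hFd w hwO]
  have hgF : ∀ y ∈ Fh.target, gradFst S y = (Γ (Fh.symm y)).1.2 := by
    intro y hy
    funext i
    rw [gradFst, hSd y hy]
    simp [Pi.single_apply]
  have hgS : ∀ y ∈ Fh.target, gradSnd S y = (Fh.symm y).1 - Pi.single 0 c := by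
    intro y hy
    funext j
    rw [gradSnd, hSd y hy, Finset.sum_eq_zero (by simp), zero_add,
      Finset.sum_eq_single j (fun k _ hk => by simp [hk]) (by simp)]
    simp
  have hyp : ∀ y ∈ Fh.target, (y.1, gradFst S y) = (Γ (Fh.symm y)).1 := fun y hy =>
    Prod.ext (hFr y hy).1.symm (hgF y hy)
  have hdet : ∀ y ∈ Fh.target, (mixedHessian S y).det ≠ 0 := by
    intro y hy hdet
    -- As ∂S/∂X = q - c e₁, the variation of q under F⁻¹ in direction (a, 0) is the row vector a
    -- times the mixed Hessian, hence zero. X does not vary either, so the derivative of F⁻¹ kills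
    -- (a, 0), contradicting F ∘ F⁻¹ = id.
    obtain ⟨a, ha0, ha⟩ := Matrix.exists_vecMul_eq_zero_iff.2 hdet
    have hSat : ContDiffAt ℝ ∞ S y := hS.contDiffAt (Fh.open_target.mem_nhds hy)
    have hsy : HasFDerivAt Fh.symm (fderiv ℝ Fh.symm y) y :=
      ((hFsymm.contDiffAt (Fh.open_target.mem_nhds hy)).differentiableAt (by simp)).hasFDerivAt
    have h1 : (fderiv ℝ Fh.symm y (a, 0)).1 = 0 := by
      funext j
      have e1 : HasFDerivAt (fun y' => (Fh.symm y').1 j - (Pi.single 0 c : Fin m → ℝ) j) _ y :=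
        (hasFDerivAt_pi'.1 hsy.fst j).sub_const _
      have e2 := e1.congr_of_eventuallyEq (f₁ := fun y' => fderiv ℝ S y' (0, Pi.single j 1)) (by
        filter_upwards [Fh.open_target.mem_nhds hy] with y' hy'
        exact congrFun (hgS y' hy') j)
      have e3 := congrArg (fun L : PhaseSpace m →L[ℝ] ℝ => L (a, 0))
        ((hasFDerivAt_fderiv_apply hSat (0, Pi.single j 1)).unique e2)
      have e4 : fderiv ℝ (fderiv ℝ S) y (a, 0) (0, Pi.single j 1)
        = (fderiv ℝ Fh.symm y (a, 0)).1 j := e3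
      rw [← e4, (isSymmSndFDerivAt_of_smooth hSat).eq]
      have e5 : ((a, 0) : PhaseSpace m) = ∑ i, a i • ((Pi.single i 1, 0) : PhaseSpace m) := by
        refine Prod.ext ?_ ?_ <;> ext k <;>
          simp [Prod.fst_sum, Prod.snd_sum, Finset.sum_apply, Pi.single_apply]
      rw [e5, map_sum]
      have e6 := congrFun ha j
      rw [Matrix.vecMul, dotProduct] at e6
      refine Eq.trans (Finset.sum_congr rfl fun i _ => ?_) e6
      rw [map_smul, smul_eq_mul]
      congr 1
      have e7 : HasFDerivAt (fun y' => gradFst S y' i) _ y :=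
        hasFDerivAt_fderiv_apply hSat (Pi.single i 1, 0)
      simp only [mixedHessian, Matrix.of_apply]
      rw [e7.fderiv]
      rfl
    have h2 : (fderiv ℝ Fh.symm y (a, 0)).2 = 0 := by
      have e1 := (hasFDerivAt_snd (𝕜 := ℝ) (p := y)).congr_of_eventuallyEq
        (f₁ := fun y' => (Fh.symm y').2) (by
          filter_upwards [Fh.open_target.mem_nhds hy] with y' hy'
          exact (hFr y' hy').2)
      exact congrArg (fun L : PhaseSpace m →L[ℝ] (Fin m → ℝ) => L (a, 0)) (hsy.snd.unique e1)
    have h3 : fderiv ℝ Fh.symm y (a, 0) = 0 := Prod.ext h1 h2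
    have hwO := hFsub (Fh.map_target hy)
    have e1 := ((hF.contDiffAt (hO.mem_nhds hwO)).differentiableAt (by simp)).hasFDerivAt.comp y hsy
    have e2 := e1.congr_of_eventuallyEq (f₁ := fun y' => y') (by
      filter_upwards [Fh.open_target.mem_nhds hy] with y' hy'
      rw [Function.comp_apply, ← hFe, Fh.right_inv hy'])
    have e3 := congrArg (fun L : PhaseSpace m →L[ℝ] PhaseSpace m => L (a, 0))
      ((hasFDerivAt_id y).unique e2)
    have e4 : ((a, 0) : PhaseSpace m) = fderiv ℝ F (Fh.symm y) (fderiv ℝ Fh.symm y (a, 0)) := e3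
    rw [h3, map_zero] at e4
    exact ha0 (congrArg Prod.fst e4)
  have hFfix : ∀ w ∈ O, w.1 0 = c → F w = w := fun w hw hwc =>
    Prod.ext (H₀.initial_position w hw.1 hwc) rfl
  -- the new coordinates
  have hR : IsOpen (Fh.source ∩ Fh ⁻¹' Fh.source) :=
    Fh.continuousOn.isOpen_inter_preimage Fh.open_source Fh.open_source
  let R := Θh.restrOpen _ hR
  let Z := R.symm.trans (parameterMap c).toOpenPartialHomeomorph
  have hZs : Z.source = R.target := by simp [Z]
  have hRsrc : ∀ y ∈ R.target, R.symm y ∈ O ∧ F (R.symm y) ∈ Fh.source ∧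
      F (R.symm y) ∈ Fh.target ∧ Fh.symm (F (R.symm y)) = R.symm y ∧ Θ (R.symm y) = y := by
    intro y hy
    have h1 := R.map_target hy
    have h2 := R.right_inv hy
    refine ⟨hΘsub h1.1, ?_, ?_, ?_, ?_⟩
    · rw [← hFe]
      exact h1.2.2
    · rw [← hFe]
      exact Fh.map_source h1.2.1
    · rw [← hFe]
      exact Fh.left_inv h1.2.1
    · rw [← hΘe]
      exact h2
  have hxX : ∀ y ∈ R.target,
      (((OpenPartialHomeomorph.refl (PhaseSpace m)) y).1, (Z y).1) = F (R.symm y) := by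
    intro y hy
    have h1 : (Γ (R.symm y)).1 = y := (hRsrc y hy).2.2.2.2
    exact Prod.ext (congrArg Prod.fst h1).symm rfl
  have hRsymm : ContDiffOn ℝ ∞ R.symm R.target := hΘsymm.mono fun y hy => hy.1
  have hRw₀ : w₀ ∈ R.source := by
    refine ⟨hΘw₀, hFw₀, ?_⟩
    rw [mem_preimage, hFe, hFfix w₀ hw₀O rfl]
    exact hFw₀
  -- On `Fh.target` alone, a point with x^1 = c might come from a parameter off the initial
  -- hyperplane. Requiring it to lie in `Fh.source`, where F fixes it, forces F⁻¹ to fix it, and S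
  -- takes the prescribed initial value.
  refine ⟨Z, Fh.target ∩ Fh.source, S, ?_, ?_, ?_, ?_, ?_, ?_, ⟨?_, ?_, ?_, ?_, ?_, ?_⟩, ?_,
    ⟨?_, ?_, ?_⟩⟩
  · rw [hZs, ← hΓw₀]
    have := R.map_source hRw₀
    have hRe : R w₀ = (Γ w₀).1 := congrFun hΘe w₀
    rwa [hRe] at this
  · intro y hy
    rw [hZs] at hy
    obtain ⟨hwO, -, -, -, hΘy⟩ := hRsrc y hy
    rw [← hΘy]
    exact hwO.2
  · rw [hZs]
    exact (contDiff_parameterMap c).comp_contDiffOn hRsymm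
  · have hZt : ∀ x ∈ Z.target, (parameterMap c).symm x ∈ R.source := by
      intro x hx
      simpa [Z] using hx
    have hRs : ContDiffOn ℝ ∞ R R.source := by
      have : (R : PhaseSpace m → PhaseSpace m) = Θ := hΘe
      rw [this]
      exact hΘ.mono fun w hw => hΘsub hw.1
    exact hRs.comp (contDiff_parameterMap_symm c).contDiffOn hZt
  · intro y hy a b
    rw [hZs] at hy
    obtain ⟨hwO, -, -, -, hΘy⟩ := hRsrc y hy
    have hsy : HasFDerivAt R.symm (fderiv ℝ R.symm y) y :=
      ((hRsymm.contDiffAt (R.open_target.mem_nhds hy)).differentiableAt (by simp)).hasFDerivAt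
    have hZd : ∀ a, fderiv ℝ Z y a =
        ((fderiv ℝ R.symm y a).2, -(fderiv ℝ R.symm y a).1) := by
      intro a
      have e1 : HasFDerivAt Z _ y := (((contDiff_parameterMap c).differentiable (by simp)
        (R.symm y)).hasFDerivAt).comp y hsy
      rw [e1.fderiv, ← fderiv_parameterMap c (R.symm y)]
      rfl
    have hΘinv : ∀ a, (fderiv ℝ Γ (R.symm y) (fderiv ℝ R.symm y a)).1 = a := by
      intro a
      rw [← hΘd _ hwO]
      have e1 := ((hΘ.contDiffAt (hO.mem_nhds hwO)).differentiableAt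
        (by simp)).hasFDerivAt.comp y hsy
      have e2 := e1.congr_of_eventuallyEq (f₁ := fun y' => y') (by
        filter_upwards [R.open_target.mem_nhds hy] with y' hy'
        exact (hRsrc y' hy').2.2.2.2.symm)
      exact (congrArg (fun L : PhaseSpace m →L[ℝ] PhaseSpace m => L a)
        ((hasFDerivAt_id y).unique e2)).symm
    have key := H₀.stdForm_fderiv hwO.1 (fderiv ℝ R.symm y a) (fderiv ℝ R.symm y b)
    rw [hΘinv, hΘinv] at key
    rw [key, hZd, hZd, stdForm]
    refine Finset.sum_congr rfl fun i _ => ?_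
    simp only [Pi.neg_apply]
    ring
  · intro y hy
    rw [hZs] at hy
    obtain ⟨hwO, -, -, -, hΘy⟩ := hRsrc y hy
    exact (congrArg h hΘy.symm).trans (H₀.energy _ hwO.1)
  · exact Fh.open_target.inter Fh.open_source
  · exact hS.mono inter_subset_left
  · exact fun w hw => hdet w hw.1
  · intro y hy
    rw [hZs] at hy
    obtain ⟨hwO, hFs, hFt, hFsy, hΘy⟩ := hRsrc y hy
    rw [hxX y hy]
    exact ⟨hFt, hFs⟩
  · intro y hy
    rw [hZs] at hy
    obtain ⟨hwO, hFs, hFt, hFsy, hΘy⟩ := hRsrc y hy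
    rw [hxX y hy, hgF _ hFt, hFsy]
    exact congrArg Prod.snd hΘy.symm
  · intro y hy
    rw [hZs] at hy
    obtain ⟨hwO, hFs, hFt, hFsy, hΘy⟩ := hRsrc y hy
    rw [hxX y hy, hgS _ hFt, hFsy, neg_sub]
    rfl
  · intro w hw
    rw [hyp w hw.1]
    exact (hFsub (Fh.map_target hw.1)).2
  · exact fun w _ => mem_univ _
  · intro w hw
    change h (w.1, gradFst S w) = w.2 0
    rw [hyp w hw.1, H₀.energy _ (hFsub (Fh.map_target hw.1)).1, (hFr w hw.1).2]
  · intro w hw hwc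
    have hwO := hFsub hw.2
    have h1 : Fh.symm w = w := by
      conv_lhs => rw [← hFfix w hwO hwc, ← hFe]
      exact Fh.left_inv hw.2
    simp only [S]
    rw [h1]
    exact H₀.initial_value w hwO.1 hwc

end Straightening

/-! ### Transfer to the manifold -/

section Lift

variable {m : ℕ} {N : Type*} [TopologicalSpace N] [ChartedSpace (PhaseSpace m) N]

theorem dpdx_eq_stdForm {e : LocalCoords m N} {z : N}
    (he : MDifferentiableAt 𝓘(ℝ, PhaseSpace m) 𝓘(ℝ, PhaseSpace m) e z)
    (u v : TangentSpace 𝓘(ℝ, PhaseSpace m) z) :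
    dpdx e z u v = stdForm (m := m) (mfderiv 𝓘(ℝ, PhaseSpace m) 𝓘(ℝ, PhaseSpace m) e z u)
      (mfderiv 𝓘(ℝ, PhaseSpace m) 𝓘(ℝ, PhaseSpace m) e z v) := by
  have key : ∀ (l : PhaseSpace m →L[ℝ] ℝ) (u : TangentSpace 𝓘(ℝ, PhaseSpace m) z),
      diff (fun z' => l (e z')) z u
        = l (mfderiv 𝓘(ℝ, PhaseSpace m) 𝓘(ℝ, PhaseSpace m) e z u) := by
    intro l u
    have h1 : HasMFDerivAt 𝓘(ℝ, PhaseSpace m) 𝓘(ℝ, ℝ) (fun z' => l (e z')) z _ :=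
      (l.hasFDerivAt (x := e z)).hasMFDerivAt.comp z he.hasMFDerivAt
    rw [diff, h1.mfderiv]
    rfl
  have h1 : ∀ (i : Fin m) u, diff (fun z' => (e z').1 i) z u
      = (show PhaseSpace m from mfderiv 𝓘(ℝ, PhaseSpace m) 𝓘(ℝ, PhaseSpace m) e z u).1 i :=
    fun i u => key ((ContinuousLinearMap.proj i).comp
      (ContinuousLinearMap.fst ℝ (Fin m → ℝ) (Fin m → ℝ))) u
  have h2 : ∀ (i : Fin m) u, diff (fun z' => (e z').2 i) z u
      = (show PhaseSpace m from mfderiv 𝓘(ℝ, PhaseSpace m) 𝓘(ℝ, PhaseSpace m) e z u).2 i :=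
    fun i u => key ((ContinuousLinearMap.proj i).comp
      (ContinuousLinearMap.snd ℝ (Fin m → ℝ) (Fin m → ℝ))) u
  simp only [dpdx, h1, h2]
  rfl

theorem mdifferentiableAt_of_mem_maximalAtlas {e : LocalCoords m N}
    (he : e ∈ IsManifold.maximalAtlas 𝓘(ℝ, PhaseSpace m) ∞ N) {z : N} (hz : z ∈ e.source) :
    MDifferentiableAt 𝓘(ℝ, PhaseSpace m) 𝓘(ℝ, PhaseSpace m) e z :=
  (contMDiffAt_of_mem_maximalAtlas he hz).mdifferentiableAt (by simp)

/-- A function smooth near a point coincides near this point with a globally smooth function. -/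
theorem exists_contDiff_eqOn {E : Type*} [NormedAddCommGroup E] [NormedSpace ℝ E]
    [FiniteDimensional ℝ E] {f : E → ℝ} {s : Set E} (hs : IsOpen s) (hf : ContDiffOn ℝ ∞ f s)
    {x : E} (hx : x ∈ s) :
    ∃ (g : E → ℝ) (D : Set E), ContDiff ℝ ∞ g ∧ IsOpen D ∧ x ∈ D ∧ D ⊆ s ∧ EqOn g f D := by
  obtain ⟨r, hr, hball⟩ := Metric.isOpen_iff.1 hs x hx
  let φ : ContDiffBump x := ⟨r / 3, r / 2, by positivity, by linarith⟩
  refine ⟨fun y => φ y * f y, Metric.ball x (r / 3), ?_, Metric.isOpen_ball,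
    Metric.mem_ball_self (by positivity), fun y hy => hball
      (Metric.ball_subset_ball (by linarith) hy), fun y hy => ?_⟩
  · rw [contDiff_iff_contDiffAt]
    intro y
    by_cases hy : y ∈ Metric.ball x r
    · exact φ.contDiff.contDiffAt.mul (hf.contDiffAt (hs.mem_nhds (hball hy)))
    · have hy' : y ∈ (Metric.closedBall x (r / 2))ᶜ := fun h =>
        hy (Metric.closedBall_subset_ball (by linarith) h)
      refine (contDiffAt_const (c := (0 : ℝ))).congr_of_eventuallyEq ?_
      filter_upwards [Metric.isClosed_closedBall.isOpen_compl.mem_nhds hy'] with a ha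
      have : φ a = 0 := φ.zero_of_le_dist (by
        simpa [Metric.mem_closedBall, not_le] using (le_of_not_ge ha : r / 2 ≤ dist a x))
      rw [this, zero_mul]
  · have : φ y = 1 := φ.one_of_mem_closedBall (Metric.ball_subset_closedBall hy)
    simp [this]

theorem contDiffOn_comp_symm {H : N → ℝ} (hH : ContMDiff 𝓘(ℝ, PhaseSpace m) 𝓘(ℝ, ℝ) ∞ H)
    {e : LocalCoords m N} (he : e ∈ IsManifold.maximalAtlas 𝓘(ℝ, PhaseSpace m) ∞ N) :
    ContDiffOn ℝ ∞ (fun y => H (e.symm y)) e.target :=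
  contMDiffOn_iff_contDiffOn.1
    (hH.comp_contMDiffOn (contMDiffOn_symm_of_mem_maximalAtlas he))

theorem stdForm_perm (σ : Equiv.Perm (Fin m)) (u v : PhaseSpace m) :
    stdForm ((u.1 ∘ σ, u.2 ∘ σ) : PhaseSpace m) (v.1 ∘ σ, v.2 ∘ σ) = stdForm u v :=
  Equiv.sum_comp σ fun i => u.2 i * v.1 i - v.2 i * u.1 i

/-- A nonzero covector has a nonzero component along `p_1` after a canonical permutation of the
coordinates. -/
theorem exists_canonical_permutation [NeZero m] {l : PhaseSpace m →L[ℝ] ℝ} (hl : l ≠ 0) :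
    ∃ L : PhaseSpace m ≃L[ℝ] PhaseSpace m, (∀ a b, stdForm (L a) (L b) = stdForm a b) ∧
      l (L.symm (0, Pi.single 0 1)) ≠ 0 := by
  let T : Fin m → ((Fin m → ℝ) ≃L[ℝ] (Fin m → ℝ)) := fun i =>
    (LinearEquiv.funCongrLeft ℝ ℝ (Equiv.swap 0 i)).toContinuousLinearEquiv
  have hT : ∀ i, (T i).symm (Pi.single 0 1) = Pi.single i 1 := fun i => by
    rw [ContinuousLinearEquiv.symm_apply_eq]
    funext k
    change _ = (Pi.single i 1 : Fin m → ℝ) (Equiv.swap 0 i k)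
    simp only [Pi.single_apply, Equiv.swap_apply_eq_iff, Equiv.swap_apply_right]
  by_cases h2 : ∃ i, l (0, Pi.single i 1) ≠ 0
  · obtain ⟨i, hi⟩ := h2
    refine ⟨(T i).prodCongr (T i), fun a b => stdForm_perm _ a b, ?_⟩
    have : ((T i).prodCongr (T i)).symm (0, Pi.single 0 1) = (0, Pi.single i 1) :=
      Prod.ext (map_zero (T i).symm) (hT i)
    rwa [this]
  · have h1 : ∃ i, l (Pi.single i 1, 0) ≠ 0 := by
      by_contra! h1
      push Not at h2
      refine hl (ContinuousLinearMap.ext fun v => ?_)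
      have h3 := fderiv_eq_sum_grad l 0 v
      simp only [l.fderiv, gradFst, gradSnd, h1, h2, zero_mul, Finset.sum_const_zero,
        add_zero] at h3
      exact h3
    obtain ⟨i, hi⟩ := h1
    -- All p-components of `l` vanish here, so positions and momenta are exchanged by (x, p) ↦ (p,
    -- -x), followed by the transposition of indices; the sign keeps the form invariant.
    refine ⟨(ContinuousLinearEquiv.prodComm ℝ _ _).trans
      ((T i).prodCongr ((T i).trans (ContinuousLinearEquiv.neg ℝ))), fun a b => ?_, ?_⟩
    · rw [← stdForm_perm (Equiv.swap 0 i) a b]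
      refine Finset.sum_congr rfl fun k _ => ?_
      change -(a.1 (Equiv.swap 0 i k)) * b.2 (Equiv.swap 0 i k)
        - -(b.1 (Equiv.swap 0 i k)) * a.2 (Equiv.swap 0 i k)
        = a.2 (Equiv.swap 0 i k) * b.1 (Equiv.swap 0 i k)
          - b.2 (Equiv.swap 0 i k) * a.1 (Equiv.swap 0 i k)
      ring
    · have : ((ContinuousLinearEquiv.prodComm ℝ _ _).trans
          ((T i).prodCongr ((T i).trans (ContinuousLinearEquiv.neg ℝ)))).symm
            ((0, Pi.single 0 1) : PhaseSpace m) = -(Pi.single i 1, 0) := by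
        refine Prod.ext ?_ ?_
        · change (T i).symm (-Pi.single 0 1) = -Pi.single i 1
          rw [map_neg, hT]
        · change (T i).symm 0 = -0
          rw [map_zero, neg_zero]
      rw [this, map_neg]
      exact neg_ne_zero.2 hi

theorem fderiv_comp_symm_ne_zero {H : N → ℝ} (hH : ContMDiff 𝓘(ℝ, PhaseSpace m) 𝓘(ℝ, ℝ) ∞ H)
    {z₀ : N} (hdH : diff (m := m) H z₀ ≠ 0) {e : LocalCoords m N}
    (he : e ∈ IsManifold.maximalAtlas 𝓘(ℝ, PhaseSpace m) ∞ N) (hz₀ : z₀ ∈ e.source) :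
    fderiv ℝ (fun y => H (e.symm y)) (e z₀) ≠ 0 := by
  intro h0
  have h1 := (((contDiffOn_comp_symm hH he).contDiffAt
    (e.open_target.mem_nhds (e.map_source hz₀))).differentiableAt (by simp)).hasFDerivAt
  rw [h0] at h1
  have h2 := h1.hasMFDerivAt.comp z₀ (mdifferentiableAt_of_mem_maximalAtlas he hz₀).hasMFDerivAt
  have h3 := h2.congr_of_eventuallyEq (f₁ := H) (by
    filter_upwards [e.open_source.mem_nhds hz₀] with z hz
    rw [Function.comp_apply, e.left_inv hz])
  refine hdH ?_
  rw [diff, h3.mfderiv]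
  rfl

variable [IsManifold 𝓘(ℝ, PhaseSpace m) ∞ N]

/-- Composing canonical coordinates with a local symplectomorphism of the phase space. -/
theorem IsCanonical.trans {β : TwoForm m N} {e : LocalCoords m N} (he : IsCanonical β e)
    (Z : OpenPartialHomeomorph (PhaseSpace m) (PhaseSpace m)) (hZ : ContDiffOn ℝ ∞ Z Z.source)
    (hZs : ContDiffOn ℝ ∞ Z.symm Z.target)
    (hform : ∀ y ∈ Z.source, ∀ a b, stdForm (fderiv ℝ Z y a) (fderiv ℝ Z y b) = stdForm a b) :
    IsCanonical β (e.trans Z) := by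
  have hmem : e.trans Z ∈ IsManifold.maximalAtlas 𝓘(ℝ, PhaseSpace m) ∞ N := by
    refine (e.trans Z).mem_maximalAtlas_of_contMDiffOn ?_ ?_
    · refine hZ.contMDiffOn.comp ((contMDiffOn_of_mem_maximalAtlas he.smooth).mono ?_) ?_
      · exact fun z hz => (e.trans_source Z ▸ hz).1
      · exact fun z hz => (e.trans_source Z ▸ hz).2
    · refine (contMDiffOn_symm_of_mem_maximalAtlas he.smooth).comp
        (hZs.contMDiffOn.mono ?_) ?_
      · exact fun z hz => (e.trans_target Z ▸ hz).1
      · exact fun z hz => (e.trans_target Z ▸ hz).2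
  refine ⟨hmem, fun z hz u v => ?_⟩
  have hz' : z ∈ e.source ∩ e ⁻¹' Z.source := by rwa [e.trans_source Z] at hz
  have hd := mdifferentiableAt_of_mem_maximalAtlas he.smooth hz'.1
  have hcomp : HasMFDerivAt 𝓘(ℝ, PhaseSpace m) 𝓘(ℝ, PhaseSpace m) (e.trans Z) z _ :=
    (((hZ.contDiffAt (Z.open_source.mem_nhds hz'.2)).differentiableAt
      (by simp)).hasFDerivAt).hasMFDerivAt.comp z hd.hasMFDerivAt
  rw [he.form_eq z hz'.1, dpdx_eq_stdForm hd,
    dpdx_eq_stdForm (mdifferentiableAt_of_mem_maximalAtlas hmem hz), hcomp.mfderiv]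
  exact (hform (e z) hz'.2 _ _).symm

/-- Straightening by a generating function, if `∂H/∂p_1 ≠ 0`. -/
theorem exists_straightening_of_gradSnd_ne_zero [NeZero m] {β : TwoForm m N} {H : N → ℝ}
    (hH : ContMDiff 𝓘(ℝ, PhaseSpace m) 𝓘(ℝ, ℝ) ∞ H) {z₀ : N} {e : LocalCoords m N}
    (he : IsCanonical β e) (hz₀ : z₀ ∈ e.source)
    (hp : gradSnd (fun y => H (e.symm y)) (e z₀) 0 ≠ 0) :
    ∃ (Z : LocalCoords m N) (W : Set (PhaseSpace m)) (S : PhaseSpace m → ℝ),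
      IsStraightening e H z₀ Z ∧ IsCanonical β Z ∧ IsGeneratingFunction e Z W S ∧
      SolvesCauchyProblem e H ((e z₀).1 0) W S := by
  -- The flow was built for globally smooth fields, so H is replaced by a globally smooth h equal to
  -- it only on D. The inclusions of `Z.source` and of the points (x, ∂S/∂x) in D let the
  -- conclusions return to H.
  obtain ⟨h, D, hh, hD, hzD, hDt, hEq⟩ := exists_contDiff_eqOn e.open_target
    (contDiffOn_comp_symm hH he.smooth) (e.map_source hz₀)
  have hp' : gradSnd h (e z₀) 0 ≠ 0 := by
    have h1 : h =ᶠ[𝓝 (e z₀)] fun y => H (e.symm y) := by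
      filter_upwards [hD.mem_nhds hzD] with y hy
      exact hEq hy
    rw [gradSnd, h1.fderiv_eq]
    exact hp
  obtain ⟨Z, W, S, hyZ, hZD, hZ, hZs, hform, hen, hgen, hWD, hsol⟩ :=
    exists_euclidean_straightening hh hD hzD hp'
  have hcan := he.trans Z hZ hZs hform
  have hsrc : ∀ z ∈ (e.trans Z).source, z ∈ e.source ∧ e z ∈ Z.source := fun z hz => by
    rwa [e.trans_source Z] at hz
  refine ⟨e.trans Z, W, S, ⟨hcan.smooth, ?_, fun z hz => (hsrc z hz).1, ?_, ?_⟩, hcan,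
    ⟨hgen.isOpen, hgen.smooth, hgen.det_ne_zero, fun z hz => hgen.mem _ (hsrc z hz).2,
      fun z hz => hgen.momentum_eq _ (hsrc z hz).2,
      fun z hz => hgen.newMomentum_eq _ (hsrc z hz).2⟩,
    ⟨fun w hw => hDt (hWD w hw), fun w hw => ?_, hsol.initial⟩⟩
  · rw [e.trans_source Z]
    exact ⟨hz₀, hyZ⟩
  · intro z hz u v
    rw [← he.form_eq z (hsrc z hz).1, hcan.form_eq z hz]
  · intro z hz
    obtain ⟨h1, h2⟩ := hsrc z hz
    have h3 := hen _ h2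
    rw [hEq (hZD h2)] at h3
    simp only [e.left_inv h1] at h3
    exact h3
  · exact (hEq (hWD w hw)).symm.trans (hsol.hamiltonJacobi w hw)

/-- Local existence of canonical coordinates in which the Hamiltonian is a coordinate. -/
theorem exists_straightening [NeZero m] {β : TwoForm m N} {H : N → ℝ}
    (hH : ContMDiff 𝓘(ℝ, PhaseSpace m) 𝓘(ℝ, ℝ) ∞ H) {z₀ : N} (hdH : diff (m := m) H z₀ ≠ 0)
    {e : LocalCoords m N} (he : IsCanonical β e) (hz₀ : z₀ ∈ e.source) :
    ∃ Z : LocalCoords m N, IsStraightening e H z₀ Z ∧ IsCanonical β Z := by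
  obtain ⟨L, hL, hl⟩ := exists_canonical_permutation
    (fderiv_comp_symm_ne_zero hH hdH he.smooth hz₀)
  have hcan := he.trans L.toHomeomorph.toOpenPartialHomeomorph L.contDiff.contDiffOn
    L.symm.contDiff.contDiffOn (fun y _ a b => by
      have : fderiv ℝ (L.toHomeomorph.toOpenPartialHomeomorph) y = L := L.fderiv
      rw [this]
      exact hL a b)
  set e' := e.trans L.toHomeomorph.toOpenPartialHomeomorph with he'
  have hsrc : e'.source = e.source := by simp [he']
  have hp : gradSnd (fun y => H (e'.symm y)) (e' z₀) 0 ≠ 0 := by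
    have h1 : HasFDerivAt (fun y => H (e.symm y)) (fderiv ℝ (fun y => H (e.symm y)) (e z₀))
        (L.symm (e' z₀)) := by
      have : L.symm (e' z₀) = e z₀ := L.symm_apply_apply _
      rw [this]
      exact (((contDiffOn_comp_symm hH he.smooth).contDiffAt
        (e.open_target.mem_nhds (e.map_source hz₀))).differentiableAt (by simp)).hasFDerivAt
    have h2 : HasFDerivAt (fun y => H (e'.symm y)) _ (e' z₀) :=
      h1.comp (e' z₀) L.symm.hasFDerivAt
    rw [gradSnd, h2.fderiv]
    exact hl
  obtain ⟨Z, -, -, hZ, hZc, -, -⟩ :=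
    exists_straightening_of_gradSnd_ne_zero hH hcan (hsrc ▸ hz₀) hp
  have hsub : Z.source ⊆ e.source := hsrc ▸ hZ.source_subset
  refine ⟨Z, ⟨hZ.smooth, hZ.mem_source, hsub, fun z hz u v => ?_, hZ.hamiltonian_eq⟩, hZc⟩
  -- `Z` was straightened relative to the permuted chart; both `e` and `Z` express the same β, which
  -- compares them directly.
  rw [← he.form_eq z (hsub hz), hZc.form_eq z hz]

end Lift

end HamStraight

theorem mainTheorem9 {m : ℕ} [NeZero m] {N : Type*} [TopologicalSpace N]
    [ChartedSpace (HamStraight.PhaseSpace m) N]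
    [IsManifold 𝓘(ℝ, HamStraight.PhaseSpace m) ∞ N]
    (β : HamStraight.TwoForm m N) (hβ : HamStraight.IsSymplectic β)
    (H : N → ℝ) (hH : ContMDiff 𝓘(ℝ, HamStraight.PhaseSpace m) 𝓘(ℝ, ℝ) ∞ H)
    (z₀ : N) (hdH : HamStraight.diff (m := m) H z₀ ≠ 0)
    (e : HamStraight.LocalCoords m N) (he : HamStraight.IsCanonical β e) (hz₀ : z₀ ∈ e.source) :
    (∃ Z : HamStraight.LocalCoords m N,
      HamStraight.IsStraightening e H z₀ Z ∧ HamStraight.IsCanonical β Z) ∧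
    (HamStraight.gradSnd (fun y => H (e.symm y)) (e z₀) 0 ≠ 0 →
      ∃ (Z : HamStraight.LocalCoords m N) (W : Set ((Fin m → ℝ) × (Fin m → ℝ)))
        (S : (Fin m → ℝ) × (Fin m → ℝ) → ℝ),
        HamStraight.IsStraightening e H z₀ Z ∧ HamStraight.IsCanonical β Z ∧
        HamStraight.IsGeneratingFunction e Z W S ∧
        HamStraight.SolvesCauchyProblem e H ((e z₀).1 0) W S) := by
  exact ⟨HamStraight.exists_straightening hH hdH he hz₀, fun hp =>
    HamStraight.exists_straightening_of_gradSnd_ne_zero hH he hz₀ hp⟩
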